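/- A triangulation of the plane is a cell decomposition of $\mathbb{R}^2$ obtained by gluing the sides of a family of triangles in pairs, so that the resulting surface is homeomorphic to $\mathbb{R}^2$ (loops and multiple edges are allowed). The degree of a vertex is the number of edges at it, loops being counted twice, and a vertex is called exceptional if its degree is not $6$. The regular triangulation of the plane is the tiling by unit equilateral triangles, with six triangles at every vertex. Two triangulations are isomorphic near infinity if, after finitely many triangles are deleted from each of them, the remaining triangles correspond bijectively, side by side, so that gluings of sides are preserved in both directions and the cyclic order of the sides is either preserved in all triangles or reversed in all triangles. Theorem (Dress). A triangulation of the plane with exactly two exceptional vertices is not isomorphic near infinity to the regular triangulation. -/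

import Mathlib

/-- A surface presented by gluing triangles: a family of triangles, each with its three sides
numbered cyclically by `Fin 3`, together with a pairing of all the sides.  The triangle `f` has
corners `0, 1, 2` in positive cyclic order, and the side `(f, i)` is directed from corner `i` to
corner `i + 1`.  A side is glued to its partner with reversed direction, as is the case
on an oriented surface all of whose triangles are positively oriented.
Two sides of the same triangle may be glued, so loops and multiple edges are allowed. -/
structure TriangleGluing where
  /-- The triangles. -/
  Face : Type*
  /-- The side to which a given side is glued. -/
  mate : Face × Fin 3 → Face × Fin 3
  mate_mate : ∀ s, mate (mate s) = s
  mate_ne : ∀ s, mate s ≠ s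

namespace TriangleGluing

/-- Sides of triangles; the side `(f, i)` of `f` is directed from corner `i` to corner `i + 1`. -/
abbrev Side (T : TriangleGluing) : Type _ := T.Face × Fin 3

/-- The cyclically next side of the same triangle. -/
def next (T : TriangleGluing) : Equiv.Perm T.Side where
  toFun s := (s.1, s.2 + 1)
  invFun s := (s.1, s.2 - 1)
  left_inv s := by simp
  right_inv s := by simp

/-- The pairing of sides, as a permutation. -/
def matePerm (T : TriangleGluing) : Equiv.Perm T.Side where
  toFun := T.mate
  invFun := T.mate
  left_inv := T.mate_mate
  right_inv := T.mate_mate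

/-- The permutation that turns each directed side around its starting vertex: the side preceding
`s` in its triangle ends where `s` starts, so its partner starts there too. -/
def rotate (T : TriangleGluing) : Equiv.Perm T.Side := T.next.symm.trans T.matePerm

/-- The vertices of the glued surface: the orbits of directed sides under turning around their
starting vertex. -/
def Vertex (T : TriangleGluing) : Type _ := Quotient (Equiv.Perm.SameCycle.setoid T.rotate)

/-- The starting vertex of a directed side. -/
def start (T : TriangleGluing) (s : T.Side) : T.Vertex :=
  Quotient.mk (Equiv.Perm.SameCycle.setoid T.rotate) s

/-- The degree of a vertex: the number of directed sides that start there, which is the number of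
edges at the vertex with loops counted twice. -/
noncomputable def degree (T : TriangleGluing) (v : T.Vertex) : ℕ∞ :=
  {s : T.Side | T.start s = v}.encard

/-- The exceptional vertices are those of degree different from `6`. -/
def exceptional (T : TriangleGluing) : Set T.Vertex := {v | T.degree v ≠ 6}

/-- The point at parameter `t` on side `i` of the standard triangle, from corner `i` at `t = 0`
to corner `i + 1` at `t = 1`, in barycentric coordinates. -/
def sidePoint (i : Fin 3) (t : unitInterval) : stdSimplex ℝ (Fin 3) :=
  ⟨fun j => if j = i then 1 - (t : ℝ) else if j = i + 1 then (t : ℝ) else 0, by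
    refine ⟨fun j => ?_, ?_⟩
    · have h0 := t.2.1
      have h1 := t.2.2
      dsimp only
      split_ifs <;> linarith
    · fin_cases i <;> simp [Fin.sum_univ_three]⟩

/-- Each point of a side is identified with the corresponding point of the partner side, which is
traversed in the opposite direction. -/
inductive Glued (T : TriangleGluing) :
    (Σ _ : T.Face, stdSimplex ℝ (Fin 3)) → (Σ _ : T.Face, stdSimplex ℝ (Fin 3)) → Prop
  | side (s : T.Side) (t : unitInterval) :
      Glued T ⟨s.1, sidePoint s.2 t⟩ ⟨(T.mate s).1, sidePoint (T.mate s).2 (unitInterval.symm t)⟩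

/-- The glued surface: the disjoint union of the closed triangles modulo the equivalence relation
generated by the side identifications, with the quotient topology. -/
def Realization (T : TriangleGluing) : Type _ := Quot T.Glued

instance (T : TriangleGluing) : TopologicalSpace T.Realization :=
  inferInstanceAs (TopologicalSpace (Quot T.Glued))

/-- The gluing is a triangulation of the plane: the glued surface is homeomorphic to `ℝ²`. -/
def IsPlane (T : TriangleGluing) : Prop :=
  Nonempty (T.Realization ≃ₜ EuclideanSpace ℝ (Fin 2))

/-- Two gluings are isomorphic near infinity: after deleting finitely many triangles from each,
there is a bijection between the remaining sides which maps triangles to triangles, either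
preserving the cyclic order of the sides in all of them or reversing it in all of them, and which
preserves and reflects the gluing of sides. -/
def IsoNearInfinity (S T : TriangleGluing) : Prop :=
  ∃ (A : Set S.Face) (B : Set T.Face), A.Finite ∧ B.Finite ∧
    ∃ φ : {s : S.Side // s.1 ∉ A} ≃ {s : T.Side // s.1 ∉ B},
      ((∀ s s', s'.1 = S.next s.1 → (φ s').1 = T.next (φ s).1) ∨
        (∀ s s', s'.1 = S.next s.1 → (φ s').1 = T.next.symm (φ s).1)) ∧
      (∀ s s', s'.1 = S.mate s.1 ↔ (φ s').1 = T.mate (φ s).1)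

/-- The gluing rule of the regular triangular tiling. -/
def regularMate : (ℤ × ℤ × Bool) × Fin 3 → (ℤ × ℤ × Bool) × Fin 3
  | ((m, n, true), 0) => ((m, n - 1, false), 0)
  | ((m, n, true), 1) => ((m, n, false), 1)
  | ((m, n, true), 2) => ((m - 1, n, false), 2)
  | ((m, n, false), 0) => ((m, n + 1, true), 0)
  | ((m, n, false), 1) => ((m, n, true), 1)
  | ((m, n, false), 2) => ((m + 1, n, true), 2)

/-- The corners of the triangles of the regular tiling.  The pair `(x, y)` stands for the point
`x + y ω` of the triangular lattice, with `ω = exp (π i / 3)`.  The triangle `(m, n, true)` has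
corners `m + n ω`, `m + n ω + 1`, `m + n ω + ω`, and the triangle `(m, n, false)` has
corners `m + n ω + 1 + ω`, `m + n ω + ω`, `m + n ω + 1`, in positive order. -/
def regularCorner : (ℤ × ℤ × Bool) → Fin 3 → ℤ × ℤ
  | (m, n, true), 0 => (m, n)
  | (m, n, true), 1 => (m + 1, n)
  | (m, n, true), 2 => (m, n + 1)
  | (m, n, false), 0 => (m + 1, n + 1)
  | (m, n, false), 1 => (m, n + 1)
  | (m, n, false), 2 => (m + 1, n)

/-- The regular triangulation of the plane: the tiling by unit equilateral triangles, whose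
vertices are the points of the triangular lattice. -/
def regular : TriangleGluing where
  Face := ℤ × ℤ × Bool
  mate := regularMate
  mate_mate := by
    rintro ⟨⟨m, n, b⟩, i⟩
    cases b <;> fin_cases i <;> simp [regularMate]
  mate_ne := by
    rintro ⟨⟨m, n, b⟩, i⟩
    cases b <;> fin_cases i <;> simp [regularMate]

/-- Glued sides of the regular tiling join the same two lattice points, in opposite directions. -/
theorem regularCorner_mate (s : (ℤ × ℤ × Bool) × Fin 3) :
    regularCorner (regularMate s).1 (regularMate s).2 = regularCorner s.1 (s.2 + 1) ∧
      regularCorner (regularMate s).1 ((regularMate s).2 + 1) = regularCorner s.1 s.2 := by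
  obtain ⟨⟨m, n, b⟩, i⟩ := s
  cases b <;> fin_cases i <;> simp [regularMate, regularCorner]

end TriangleGluing

/-!
Suppose that the triangulation agrees with the regular one outside a finite core. Laying out the
triangles in the plane one after the other, one obtains a rotation by a multiple of `π / 3` for
every way of going around a vertex. If `q` is a fixed point of all these rotations, then the
position `P s` of `q` in the coordinate in which the side `s` goes from `0` to `1` does not depend
on the way in which `s` was reached.

Such a function `P` exists. Around a disc with six-valent collar the combinatorial Gauss–Bonnet
formula shows that the two exceptional degrees add up to at most `12`, so neither of them is a
multiple of `6` and both rotations are nontrivial. A function that is only defined on triangles,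
and outside the core up to a common translation, fails to be compatible with the gluing by a
function on the edges of the core, which satisfies one linear condition at each ordinary vertex. The
sequence `kᶠ × k → kᵉ → kᵛ` of these maps is injective at the left, because a rotation around an
exceptional vertex is nontrivial, and surjective at the right, because there is an exceptional
vertex. Since `f + 1 - e + v ≥ 0` by Euler's inequality, for the `v` ordinary vertices, it is exact,
and the exceptional degrees add up to exactly `12`.

Now `P` vanishes on the `12` sides that start at the exceptional vertices. As `P` is carried by
translations of the developed plane, there are also `12` sides far away with any common large value
of `P`; but only six sides of the regular triangulation see a given point in a given position.
-/

namespace TriangleGluing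

/-! ### Dimension counts -/

section DimensionCounts

variable {R M N P : Type*} [CommRing R] [IsDomain R]
  [AddCommGroup M] [Module R M] [Module.Finite R M] [AddCommGroup N] [Module R N]
  [AddCommGroup P] [Module R P]

theorem finrank_range_add_finrank_ker_of_isDomain (f : M →ₗ[R] N) :
    Module.finrank R f.range + Module.finrank R f.ker = Module.finrank R M := by
  rw [← f.quotKerEquivRange.finrank_eq, Submodule.finrank_quotient_add_finrank]

theorem finrank_add_finrank_ker_le [IsNoetherianRing R] [Module.Finite R N] [Module.Finite R P]
    (f : M →ₗ[R] N) (g : N →ₗ[R] P)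
    (hker : g.ker ≤ f.range) :
    Module.finrank R N + Module.finrank R f.ker ≤ Module.finrank R M + Module.finrank R P := by
  have hf := finrank_range_add_finrank_ker_of_isDomain f
  have hg := finrank_range_add_finrank_ker_of_isDomain g
  have hmono := Submodule.finrank_mono hker
  have hrange := g.range.finrank_le
  omega

end DimensionCounts

theorem range_eq_ker_of_finrank_le {k M N P : Type*} [Field k]
    [AddCommGroup M] [Module k M] [FiniteDimensional k M]
    [AddCommGroup N] [Module k N] [FiniteDimensional k N]
    [AddCommGroup P] [Module k P] [FiniteDimensional k P]
    {f : M →ₗ[k] N} {g : N →ₗ[k] P} (hf : Function.Injective f) (hg : Function.Surjective g)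
    (hle : f.range ≤ g.ker)
    (hdim : Module.finrank k N ≤ Module.finrank k M + Module.finrank k P) :
    f.range = g.ker ∧ Module.finrank k N = Module.finrank k M + Module.finrank k P := by
  have hrange := LinearMap.finrank_range_of_inj hf
  have hker := g.finrank_range_add_finrank_ker
  rw [LinearMap.range_eq_top.2 hg, finrank_top] at hker
  have hmono := Submodule.finrank_mono hle
  exact ⟨Submodule.eq_of_le_of_finrank_le hle (by omega), by omega⟩

theorem finrank_pi_coe_set {k α : Type*} [CommRing k] [Nontrivial k] {A : Set α}
    (hA : A.Finite) : Module.finrank k (A → k) = A.ncard := by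
  have := hA.fintype
  rw [Module.finrank_fintype_fun_eq_card, ← Nat.card_eq_fintype_card, Nat.card_coe_set_eq]

/-! ### Turning around a vertex -/

section Rotation

variable (T : TriangleGluing)

theorem next_symm_apply (s : T.Side) : T.next.symm s = T.next (T.next s) := by
  rw [Equiv.symm_apply_eq]
  obtain ⟨f, i⟩ := s
  fin_cases i <;> simp [next]

theorem next_next_next (s : T.Side) : T.next (T.next (T.next s)) = s := by
  rw [← next_symm_apply, Equiv.symm_apply_apply]

theorem mate_injective : Function.Injective T.mate := T.matePerm.injective

theorem rotate_apply (s : T.Side) : T.rotate s = T.mate (T.next.symm s) := rfl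

theorem rotate_next (s : T.Side) : T.rotate (T.next s) = T.mate s := by
  rw [rotate_apply, Equiv.symm_apply_apply]

theorem start_surjective : Function.Surjective T.start := Quotient.mk_surjective

variable {T}

theorem start_eq_start_iff {s t : T.Side} : T.start s = T.start t ↔ T.rotate.SameCycle s t :=
  Quotient.eq (r := Equiv.Perm.SameCycle.setoid T.rotate)

theorem exists_vertex_lift {α : Type*} {f : T.Side → α} (hf : ∀ s, f (T.rotate s) = f s) :
    ∃ g : T.Vertex → α, ∀ s, g (T.start s) = f s := by
  refine ⟨Quotient.lift f ?_, fun _ ↦ rfl⟩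
  rintro s _ ⟨i, rfl⟩
  have hzpow : ∀ i : ℤ, f ((T.rotate ^ i) s) = f s := fun i ↦ by
    induction i with
    | zero => rfl
    | succ i ih => rw [add_comm, zpow_add, zpow_one, Equiv.Perm.mul_apply, hf, ih]
    | pred i ih => rw [← hf, ← Equiv.Perm.mul_apply, ← zpow_one_add, add_sub_cancel, ih]
  exact (hzpow i).symm

variable (T)

theorem start_rotate (s : T.Side) : T.start (T.rotate s) = T.start s :=
  start_eq_start_iff.2 (Equiv.Perm.sameCycle_apply_left.2 (Equiv.Perm.SameCycle.refl _ _))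

theorem start_rotate_iterate (n : ℕ) (s : T.Side) : T.start (T.rotate^[n] s) = T.start s := by
  induction n with
  | zero => rfl
  | succ n ih => rw [Function.iterate_succ_apply', start_rotate, ih]

theorem start_next (s : T.Side) : T.start (T.next s) = T.start (T.mate s) := by
  rw [← rotate_next, start_rotate]

theorem degree_start (s : T.Side) :
    T.degree (T.start s) = ENat.card (ZMod (Function.minimalPeriod T.rotate s)) := by
  have horbit : {t | T.start t = T.start s} =
      MulAction.orbit (Subgroup.zpowers T.rotate) s := by
    ext t
    rw [Set.mem_ofPred_eq, eq_comm, start_eq_start_iff]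
    refine ⟨fun ⟨i, hi⟩ ↦ ⟨⟨_, i, rfl⟩, hi⟩, ?_⟩
    rintro ⟨⟨_, i, rfl⟩, ht⟩
    exact ⟨i, ht⟩
  rw [degree, horbit, ← ENat.card_coe_set_eq,
    ENat.card_congr (MulAction.orbitZPowersEquiv T.rotate s)]
  rfl

variable {T}

theorem degree_start_eq_coe_iff {s : T.Side} {n : ℕ} (hn : n ≠ 0) :
    T.degree (T.start s) = n ↔ Function.minimalPeriod T.rotate s = n := by
  rw [degree_start]
  cases h : Function.minimalPeriod T.rotate s with
  | zero => simp [ZMod, hn.symm]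
  | succ p => simp [ZMod, ENat.card_eq_coe_fintype_card, -Nat.cast_add]

theorem exists_rotate_iterate_eq {s t : T.Side} {p : ℕ} (hp : 0 < p)
    (hs : T.rotate^[p] s = s) (h : T.start t = T.start s) : ∃ j < p, T.rotate^[j] s = t := by
  obtain ⟨i, rfl⟩ := start_eq_start_iff.1 h.symm
  have hpos : (0 : ℤ) < p := by exact_mod_cast hp
  have hfix : (T.rotate ^ (p * (i / p))) s = s := by
    rw [zpow_mul, zpow_natCast]
    exact Function.IsFixedPt.perm_zpow
      (by rwa [Function.IsFixedPt, ← Equiv.Perm.iterate_eq_pow]) _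
  obtain ⟨j, hj⟩ := Int.eq_ofNat_of_zero_le (Int.emod_nonneg i hpos.ne')
  refine ⟨j, by have := Int.emod_lt_of_pos i hpos; omega, ?_⟩
  rw [Equiv.Perm.iterate_eq_pow, ← zpow_natCast, ← hj]
  conv_rhs => rw [← Int.emod_add_mul_ediv i p, zpow_add, Equiv.Perm.mul_apply, hfix]

end Rotation

/-! ### Cocycles on the plane -/

section Plane

variable {T : TriangleGluing}

theorem exists_continuous_lift {Y : Type*} [TopologicalSpace Y]
    (F : T.Face → stdSimplex ℝ (Fin 3) → Y) (hF : ∀ f, Continuous (F f))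
    (hglue : ∀ (s : T.Side) (t : unitInterval), F s.1 (sidePoint s.2 t) =
      F (T.mate s).1 (sidePoint (T.mate s).2 (unitInterval.symm t))) :
    ∃ g : C(T.Realization, Y), ∀ f x, g (Quot.mk T.Glued ⟨f, x⟩) = F f x := by
  refine ⟨⟨Quot.lift (fun p ↦ F p.1 p.2) ?_, ?_⟩, fun f x ↦ rfl⟩
  · rintro _ _ ⟨s, t⟩
    exact hglue s t
  · exact continuous_coinduced_dom.2 (continuous_sigma hF)

theorem continuous_mk_triangle (f : T.Face) :
    Continuous fun x : stdSimplex ℝ (Fin 3) ↦ (Quot.mk T.Glued ⟨f, x⟩ : T.Realization) :=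
  (continuous_coinduced_rng (f := Quot.mk T.Glued)).comp
    (continuous_sigmaMk (σ := fun _ : T.Face ↦ stdSimplex ℝ (Fin 3)) (i := f))

theorem IsPlane.exists_real_lift (h : T.IsPlane) (f : C(T.Realization, UnitAddCircle)) :
    ∃ g : C(T.Realization, ℝ), ∀ x, ((g x : ℝ) : UnitAddCircle) = f x := by
  obtain ⟨e⟩ := h
  obtain ⟨r, hr⟩ := QuotientAddGroup.mk_surjective (f (e.symm 0))
  obtain ⟨g, ⟨-, hg⟩, -⟩ := (AddCircle.isCoveringMap_coe (1 : ℝ)).existsUnique_continuousMap_lifts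
    (f.comp (e.symm : C(EuclideanSpace ℝ (Fin 2), T.Realization))) (0 : EuclideanSpace ℝ (Fin 2))
    r hr
  refine ⟨g.comp (e : C(T.Realization, EuclideanSpace ℝ (Fin 2))), fun x ↦ ?_⟩
  simpa using congrFun hg (e x)

theorem exists_eq_add_intCast_of_coe_eq {X : Type*} [TopologicalSpace X] [PreconnectedSpace X]
    {F G : X → ℝ} (hF : Continuous F) (hG : Continuous G)
    (h : ∀ x, (F x : UnitAddCircle) = G x) : ∃ n : ℤ, ∀ x, F x = G x + n := by
  rcases isEmpty_or_nonempty X with _ | ⟨⟨x₀⟩⟩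
  · exact ⟨0, isEmptyElim⟩
  · obtain ⟨n, hn⟩ := AddSubgroup.mem_zmultiples_iff.1 (QuotientAddGroup.eq_iff_sub_mem.1 (h x₀))
    have hn : (n : ℝ) = F x₀ - G x₀ := by simpa using hn
    refine ⟨n, congrFun ((AddCircle.isCoveringMap_coe (1 : ℝ)).eq_of_comp_eq hF
      (hG.add continuous_const) (funext fun x ↦ ?_) x₀ (by linarith))⟩
    simp [h x]

/-- The affine function on the triangle `f` that vanishes at its corner `0` and changes by `c s`
along each side `s`, provided that `c` sums to `0` over the sides of `f`. -/
def faceHeight (c : T.Side → ℤ) (f : T.Face) (x : stdSimplex ℝ (Fin 3)) : ℝ :=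
  x.1 1 * c (f, 0) - x.1 2 * c (f, 2)

/-- The value of `faceHeight c` at the corner where the side `s` starts. -/
def cornerHeight (c : T.Side → ℤ) (s : T.Side) : ℤ := ![0, c (s.1, 0), -c (s.1, 2)] s.2

theorem continuous_faceHeight (c : T.Side → ℤ) (f : T.Face) : Continuous (faceHeight c f) := by
  have hcoord (j : Fin 3) : Continuous fun x : stdSimplex ℝ (Fin 3) ↦ x.1 j :=
    (continuous_apply j).comp continuous_subtype_val
  exact ((hcoord 1).mul continuous_const).sub ((hcoord 2).mul continuous_const)

theorem faceHeight_sidePoint {c : T.Side → ℤ}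
    (hclosed : ∀ s, c s + c (T.next s) + c (T.next (T.next s)) = 0)
    (s : T.Side) (t : unitInterval) :
    faceHeight c s.1 (sidePoint s.2 t) = cornerHeight c s + t * c s := by
  obtain ⟨f, i⟩ := s
  have hsum : (c (f, 0) : ℝ) + c (f, 1) + c (f, 2) = 0 := by exact_mod_cast hclosed (f, 0)
  fin_cases i <;> simp [faceHeight, cornerHeight, sidePoint]
  · linear_combination -(t : ℝ) * hsum
  · ring

theorem cornerHeight_next {c : T.Side → ℤ}
    (hclosed : ∀ s, c s + c (T.next s) + c (T.next (T.next s)) = 0) (s : T.Side) :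
    cornerHeight c (T.next s) = cornerHeight c s + c s := by
  obtain ⟨f, i⟩ := s
  have hsum : c (f, 0) + c (f, 1) + c (f, 2) = 0 := hclosed (f, 0)
  fin_cases i
  · simp [cornerHeight, next]
  · simp only [cornerHeight, next]
    simp
    linarith
  · simp [cornerHeight, next]

/-- The heights on the triangles agree modulo `1` along glued sides, so they form a map from the
plane to the circle, and the potential is read off from a lift of that map to `ℝ`. -/
theorem IsPlane.exists_potential (h : T.IsPlane) {c : T.Side → ℤ}
    (hanti : ∀ s, c (T.mate s) = -c s)
    (hclosed : ∀ s, c s + c (T.next s) + c (T.next (T.next s)) = 0) :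
    ∃ ψ : T.Vertex → ℤ, ∀ s, c s = ψ (T.start (T.mate s)) - ψ (T.start s) := by
  obtain ⟨g, hg⟩ := exists_continuous_lift (fun f x ↦ (faceHeight c f x : UnitAddCircle))
    (fun f ↦ (AddCircle.continuous_mk' 1).comp (continuous_faceHeight c f)) (fun s t ↦ by
      rw [faceHeight_sidePoint hclosed, faceHeight_sidePoint hclosed, hanti, ← sub_eq_zero,
        ← AddCircle.coe_sub, AddCircle.coe_eq_zero_iff]
      refine ⟨cornerHeight c s - cornerHeight c (T.mate s) + c s, ?_⟩
      simp only [zsmul_eq_mul, mul_one, unitInterval.coe_symm_eq]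
      push_cast
      ring)
  obtain ⟨G, hG⟩ := h.exists_real_lift g
  have : PreconnectedSpace (stdSimplex ℝ (Fin 3)) :=
    Subtype.preconnectedSpace (convex_stdSimplex ℝ (Fin 3)).isPreconnected
  choose m hm using fun f : T.Face ↦ exists_eq_add_intCast_of_coe_eq
    (G.continuous.comp (continuous_mk_triangle f)) (continuous_faceHeight c f)
    (fun x ↦ (hG _).trans (hg f x))
  have hval : ∀ (s : T.Side) (t : unitInterval), G (Quot.mk T.Glued ⟨s.1, sidePoint s.2 t⟩) =
      cornerHeight c s + t * c s + m s.1 := fun s t ↦ by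
    rw [← faceHeight_sidePoint hclosed]
    exact hm s.1 _
  have hmate : ∀ s, cornerHeight c (T.mate s) + m (T.mate s).1 =
      cornerHeight c s + c s + m s.1 := fun s ↦ by
    have hglue := congrArg G (Quot.sound (Glued.side s 1))
    rw [hval, hval] at hglue
    simp only [unitInterval.symm_one, Set.Icc.coe_zero, Set.Icc.coe_one, zero_mul, add_zero,
      one_mul] at hglue
    exact_mod_cast hglue.symm
  obtain ⟨ψ, hψ⟩ := exists_vertex_lift (f := fun s ↦ cornerHeight c s + m s.1) fun s ↦ by
    obtain ⟨s, rfl⟩ := T.next.surjective s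
    rw [rotate_next, hmate, cornerHeight_next hclosed]
    rfl
  exact ⟨ψ, fun s ↦ by rw [hψ, hψ, hmate]; ring⟩

theorem IsPlane.preconnectedSpace (h : T.IsPlane) : PreconnectedSpace T.Realization := by
  obtain ⟨e⟩ := h
  exact e.symm.surjective.denseRange.preconnectedSpace e.symm.continuous

theorem IsPlane.side_induction (h : T.IsPlane) {Q : T.Side → Prop}
    (hnext : ∀ s, Q s → Q (T.next s)) (hmate : ∀ s, Q s → Q (T.mate s)) {s₀ : T.Side} (h₀ : Q s₀)
    (s : T.Side) : Q s := by
  classical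
  have hface : ∀ f i j, Q (f, i) → Q (f, j) := fun f i j hi ↦ by
    have h1 : Q (f, i + 1) := hnext _ hi
    have h2 : Q (f, i + 1 + 1) := hnext _ h1
    fin_cases i <;> fin_cases j <;> first | exact hi | exact h1 | exact h2
  have hmate_iff : ∀ s, Q s ↔ Q (T.mate s) := fun s ↦
    ⟨hmate s, fun hs ↦ T.mate_mate s ▸ hmate _ hs⟩
  have hzero_iff : ∀ s : T.Side, Q (s.1, 0) ↔ Q s := fun s ↦ ⟨hface _ _ _, hface _ _ _⟩
  obtain ⟨g, hg⟩ := exists_continuous_lift (T := T) (fun f _ ↦ decide (Q (f, 0)))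
    (fun f ↦ continuous_const) (fun s _ ↦ decide_eq_decide.2 <|
      (hzero_iff s).trans <| (hmate_iff s).trans (hzero_iff _).symm)
  have hconst := PreconnectedSpace.constant h.preconnectedSpace g.continuous
    (x := Quot.mk T.Glued ⟨s₀.1, sidePoint 0 0⟩) (y := Quot.mk T.Glued ⟨s.1, sidePoint 0 0⟩)
  rw [hg, hg] at hconst
  exact (hzero_iff s).1 ((decide_eq_decide.1 hconst).1 ((hzero_iff s₀).2 h₀))

end Plane

/-! ### The regular triangulation -/

section Regular

/-- The lattice point at which a side of the regular triangulation starts. -/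
def corner (s : regular.Side) : ℤ × ℤ := regularCorner s.1 s.2

/-- The explicit form of the rotation of the regular triangulation. -/
def regularRotate : (ℤ × ℤ × Bool) × Fin 3 → (ℤ × ℤ × Bool) × Fin 3
  | ((m, n, true), 0) => ((m - 1, n, false), 2)
  | ((m, n, true), 1) => ((m, n - 1, false), 0)
  | ((m, n, true), 2) => ((m, n, false), 1)
  | ((m, n, false), 0) => ((m + 1, n, true), 2)
  | ((m, n, false), 1) => ((m, n + 1, true), 0)
  | ((m, n, false), 2) => ((m, n, true), 1)

theorem coe_regular_rotate : ⇑regular.rotate = regularRotate := by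
  funext s
  obtain ⟨⟨m, n, b⟩, i⟩ := s
  cases b <;> fin_cases i <;> rfl

theorem corner_mate (s : regular.Side) : corner (regular.mate s) = corner (regular.next s) :=
  (regularCorner_mate s).1

theorem corner_next_mate (s : regular.Side) : corner (regular.next (regular.mate s)) = corner s :=
  (regularCorner_mate s).2

theorem corner_rotate (s : regular.Side) : corner (regular.rotate s) = corner s := by
  rw [rotate_apply, corner_mate, Equiv.apply_symm_apply]

theorem corner_rotate_iterate (n : ℕ) (s : regular.Side) :
    corner (regular.rotate^[n] s) = corner s := by
  induction n with
  | zero => rfl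
  | succ n ih => rw [Function.iterate_succ_apply', corner_rotate, ih]

theorem minimalPeriod_regularRotate (s : (ℤ × ℤ × Bool) × Fin 3) :
    Function.minimalPeriod regularRotate s = 6 := by
  have h6 : Function.IsPeriodicPt regularRotate 6 s := by
    obtain ⟨⟨m, n, b⟩, i⟩ := s
    cases b <;> fin_cases i <;> simp [Function.IsPeriodicPt, Function.IsFixedPt, regularRotate]
  have h2 : ¬ Function.IsPeriodicPt regularRotate 2 s := by
    obtain ⟨⟨m, n, b⟩, i⟩ := s
    cases b <;> fin_cases i <;> simp [Function.IsPeriodicPt, Function.IsFixedPt, regularRotate]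
  have h3 : ¬ Function.IsPeriodicPt regularRotate 3 s := by
    obtain ⟨⟨m, n, b⟩, i⟩ := s
    cases b <;> fin_cases i <;> simp [Function.IsPeriodicPt, Function.IsFixedPt, regularRotate]
  rw [Function.isPeriodicPt_iff_minimalPeriod_dvd] at h2 h3 h6
  have hle := Nat.le_of_dvd (by norm_num) h6
  generalize Function.minimalPeriod regularRotate s = p at h2 h3 h6 hle
  interval_cases p <;> simp_all

theorem minimalPeriod_regular_rotate (s : regular.Side) :
    Function.minimalPeriod regular.rotate s = 6 := by
  rw [coe_regular_rotate]
  exact minimalPeriod_regularRotate s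

theorem isPeriodicPt_regular_rotate (s : regular.Side) :
    Function.IsPeriodicPt regular.rotate 6 s :=
  minimalPeriod_regular_rotate s ▸ Function.isPeriodicPt_minimalPeriod _ _

/-- The side from `x` to `x + 1` of the triangle above it. -/
def regularBase (x : ℤ × ℤ) : regular.Side := ((x.1, x.2, true), 0)

theorem corner_regularBase (x : ℤ × ℤ) : corner (regularBase x) = x := rfl

theorem exists_regularRotate_iterate (s : (ℤ × ℤ × Bool) × Fin 3) :
    ∃ j < 6,
      regularRotate^[j] (((regularCorner s.1 s.2).1, (regularCorner s.1 s.2).2, true), 0) = s := by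
  obtain ⟨⟨m, n, b⟩, i⟩ := s
  cases b <;> fin_cases i
  · exact ⟨3, by norm_num, by simp [regularRotate, regularCorner]⟩
  · exact ⟨5, by norm_num, by simp [regularRotate, regularCorner]⟩
  · exact ⟨1, by norm_num, by simp [regularRotate, regularCorner]⟩
  · exact ⟨0, by norm_num, by simp [regularCorner]⟩
  · exact ⟨2, by norm_num, by simp [regularRotate, regularCorner]⟩
  · exact ⟨4, by norm_num, by simp [regularRotate, regularCorner]⟩

theorem exists_rotate_iterate_regularBase (s : regular.Side) :
    ∃ j < 6, regular.rotate^[j] (regularBase (corner s)) = s := by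
  rw [coe_regular_rotate]
  exact exists_regularRotate_iterate s

theorem regular_start_eq_start_iff {s t : regular.Side} :
    regular.start s = regular.start t ↔ corner s = corner t := by
  constructor
  · intro h
    obtain ⟨j, -, rfl⟩ := exists_rotate_iterate_eq (by norm_num) (isPeriodicPt_regular_rotate t) h
    exact corner_rotate_iterate j t
  · intro h
    obtain ⟨i, -, hi⟩ := exists_rotate_iterate_regularBase s
    obtain ⟨j, -, hj⟩ := exists_rotate_iterate_regularBase t
    rw [← hi, ← hj, start_rotate_iterate, start_rotate_iterate, h]

theorem regular_degree (v : regular.Vertex) : regular.degree v = 6 := by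
  obtain ⟨s, rfl⟩ := regular.start_surjective v
  exact (degree_start_eq_coe_iff (n := 6) (by norm_num)).2 (minimalPeriod_regular_rotate s)

/-- The reflection of the regular triangulation that exchanges the two lattice coordinates, on
triangles. -/
def reflectFace (f : regular.Face) : regular.Face := (f.2.1, f.1, f.2.2)

/-- The reflection of the regular triangulation that exchanges the two lattice coordinates, on
sides. -/
def reflectSide (s : regular.Side) : regular.Side := (reflectFace s.1, 2 - s.2)

theorem reflectSide_involutive : Function.Involutive reflectSide :=
  fun _ ↦ Prod.ext rfl (sub_sub_cancel _ _)

theorem reflectSide_mate (s : regular.Side) :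
    reflectSide (regular.mate s) = regular.mate (reflectSide s) := by
  obtain ⟨⟨m, n, b⟩, i⟩ := s
  cases b <;> fin_cases i <;> simp [reflectSide, reflectFace, regular, regularMate]

theorem reflectSide_next_symm (s : regular.Side) :
    reflectSide (regular.next.symm s) = regular.next (reflectSide s) := by
  obtain ⟨⟨m, n, b⟩, i⟩ := s
  fin_cases i <;> simp [reflectSide, next]

end Regular

/-! ### Sets of triangles -/

section FaceSets

variable {T : TriangleGluing} {A : Set T.Face}

/-- The corners of the triangles in `A`. -/
def verticesOf (T : TriangleGluing) (A : Set T.Face) : Set T.Vertex := T.start '' {s | s.1 ∈ A}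

/-- The sides of the triangles in `A`, together with their partners: two directed sides for each
edge of a triangle in `A`. -/
def sidesOf (T : TriangleGluing) (A : Set T.Face) : Set T.Side :=
  {s | s.1 ∈ A ∨ (T.mate s).1 ∈ A}

/-- The sides of triangles outside `A` that are glued to a side of a triangle in `A`. -/
def boundarySides (T : TriangleGluing) (A : Set T.Face) : Set T.Side :=
  {s | s.1 ∉ A ∧ (T.mate s).1 ∈ A}

/-- The sides of triangles outside `A` that start at a corner of a triangle in `A`. -/
def collarSides (T : TriangleGluing) (A : Set T.Face) : Set T.Side :=
  {s | s.1 ∉ A ∧ T.start s ∈ T.verticesOf A}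

theorem mate_mem_sidesOf {s : T.Side} : T.mate s ∈ T.sidesOf A ↔ s ∈ T.sidesOf A := by
  simp only [sidesOf, Set.mem_ofPred_eq, T.mate_mate]
  exact or_comm

theorem start_mem_verticesOf {s : T.Side} (hs : s ∈ T.sidesOf A) :
    T.start s ∈ T.verticesOf A := by
  rcases hs with hs | hs
  · exact ⟨s, hs, rfl⟩
  · exact ⟨T.next (T.mate s), hs, by rw [start_next, T.mate_mate]⟩

theorem start_notMem_verticesOf_iff {s : T.Side} {p : ℕ} (hp : 0 < p) (hs : T.rotate^[p] s = s) :
    T.start s ∉ T.verticesOf A ↔ ∀ n, (T.rotate^[n] s).1 ∉ A := by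
  constructor
  · exact fun h n hn ↦ h ⟨_, hn, T.start_rotate_iterate n s⟩
  · rintro h ⟨t, ht, hts⟩
    obtain ⟨j, -, rfl⟩ := exists_rotate_iterate_eq hp hs hts
    exact h j ht

end FaceSets

/-! ### Isomorphisms outside given sets of triangles -/

/-- An orientation preserving isomorphism between the complements of two sets of triangles. The
values on the sides of the deleted triangles are irrelevant. -/
structure OuterIso (S T : TriangleGluing) (A : Set S.Face) (B : Set T.Face) where
  /-- The map on sides. -/
  map : S.Side → T.Side
  /-- The inverse map on sides. -/
  inv : T.Side → S.Side
  map_outer : ∀ s, s.1 ∉ A → (map s).1 ∉ B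
  inv_outer : ∀ t, t.1 ∉ B → (inv t).1 ∉ A
  inv_map : ∀ s, s.1 ∉ A → inv (map s) = s
  map_inv : ∀ t, t.1 ∉ B → map (inv t) = t
  map_next : ∀ s, s.1 ∉ A → map (S.next s) = T.next (map s)
  map_mate : ∀ s, s.1 ∉ A → (S.mate s).1 ∉ A → map (S.mate s) = T.mate (map s)
  inv_mate : ∀ t, t.1 ∉ B → (T.mate t).1 ∉ B → inv (T.mate t) = S.mate (inv t)

namespace OuterIso

variable {S T : TriangleGluing} {A : Set S.Face} {B : Set T.Face}

open Classical in
/-- The isomorphism given by a bijection between the sides outside two sets of triangles. -/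
noncomputable def ofEquiv [Nonempty S.Side] [Nonempty T.Side]
    (φ : {s : S.Side // s.1 ∉ A} ≃ {t : T.Side // t.1 ∉ B})
    (hnext : ∀ s s', s'.1 = S.next s.1 → (φ s').1 = T.next (φ s).1)
    (hmate : ∀ s s', s'.1 = S.mate s.1 ↔ (φ s').1 = T.mate (φ s).1) : OuterIso S T A B where
  map s := if h : s.1 ∉ A then φ ⟨s, h⟩ else Classical.arbitrary _
  inv t := if h : t.1 ∉ B then φ.symm ⟨t, h⟩ else Classical.arbitrary _
  map_outer s h := by
    rw [dif_pos h]
    exact (φ _).2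
  inv_outer t h := by
    rw [dif_pos h]
    exact (φ.symm _).2
  inv_map s h := by simp [h, (φ ⟨s, h⟩).2]
  map_inv t h := by simp [h, (φ.symm ⟨t, h⟩).2]
  map_next s h := by
    rw [dif_pos h, dif_pos (show (S.next s).1 ∉ A from h)]
    exact hnext _ _ rfl
  map_mate s h h' := by
    rw [dif_pos h, dif_pos h']
    exact (hmate _ _).1 rfl
  inv_mate t h h' := by
    rw [dif_pos h, dif_pos h']
    exact (hmate _ _).2 (by simp)

theorem inv_next (e : OuterIso S T A B) {t : T.Side} (ht : t.1 ∉ B) :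
    e.inv (T.next t) = S.next (e.inv t) := by
  have h := e.inv_outer t ht
  rw [← e.inv_map (S.next (e.inv t)) h, e.map_next _ h, e.map_inv t ht]

/-- The inverse isomorphism. -/
def symm (e : OuterIso S T A B) : OuterIso T S B A where
  map := e.inv
  inv := e.map
  map_outer := e.inv_outer
  inv_outer := e.map_outer
  inv_map := e.map_inv
  map_inv := e.inv_map
  map_next _ ht := e.inv_next ht
  map_mate := e.inv_mate
  inv_mate := e.map_mate

theorem map_rotate (e : OuterIso S T A B) {s : S.Side} (hs : s.1 ∉ A) (hr : (S.rotate s).1 ∉ A) :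
    e.map (S.rotate s) = T.rotate (e.map s) := by
  rw [rotate_apply, e.map_mate _ (by exact hs) hr, rotate_apply, next_symm_apply, next_symm_apply,
    e.map_next _ (by exact hs), e.map_next _ hs]

theorem map_rotate_iterate (e : OuterIso S T A B) {s : S.Side} (h : ∀ n, (S.rotate^[n] s).1 ∉ A)
    (n : ℕ) : e.map (S.rotate^[n] s) = T.rotate^[n] (e.map s) := by
  induction n with
  | zero => rfl
  | succ n ih =>
    have hsucc := h (n + 1)
    rw [Function.iterate_succ_apply'] at hsucc
    rw [Function.iterate_succ_apply', Function.iterate_succ_apply', ← ih,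
      e.map_rotate (h n) hsucc]

theorem mate_outer_iff (e : OuterIso S T A B) {s : S.Side} (hs : s.1 ∉ A) :
    (S.mate s).1 ∉ A ↔ (T.mate (e.map s)).1 ∉ B := by
  constructor
  · intro h
    rw [← e.map_mate s hs h]
    exact e.map_outer _ h
  · intro h
    have hmate := e.inv_mate _ (e.map_outer s hs) h
    rw [e.inv_map s hs] at hmate
    rw [← hmate]
    exact e.inv_outer _ h

theorem rotate_iterate_eq_iff (e : OuterIso S T A B) {s : S.Side}
    (h : ∀ n, (S.rotate^[n] s).1 ∉ A) (n : ℕ) :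
    S.rotate^[n] s = s ↔ T.rotate^[n] (e.map s) = e.map s := by
  rw [← e.map_rotate_iterate h]
  exact ⟨congrArg e.map, fun hn ↦ by rw [← e.inv_map _ (h n), hn, e.inv_map s (h 0)]⟩

theorem minimalPeriod_rotate (e : OuterIso S T A B) {s : S.Side}
    (h : ∀ n, (S.rotate^[n] s).1 ∉ A) :
    Function.minimalPeriod S.rotate s = Function.minimalPeriod T.rotate (e.map s) :=
  Function.minimalPeriod_eq_minimalPeriod_iff.2 fun n ↦ e.rotate_iterate_eq_iff h n

theorem forall_rotate_iterate_outer_iff (e : OuterIso S T A B) {s : S.Side} (hs : s.1 ∉ A) :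
    (∀ n, (S.rotate^[n] s).1 ∉ A) ↔ ∀ n, (T.rotate^[n] (e.map s)).1 ∉ B := by
  constructor
  · intro h n
    rw [← e.map_rotate_iterate h]
    exact e.map_outer _ (h n)
  · intro h n
    have hn := e.symm.map_rotate_iterate h n
    change e.inv _ = S.rotate^[n] (e.inv (e.map s)) at hn
    rw [e.inv_map s hs] at hn
    rw [← hn]
    exact e.inv_outer _ (h n)

theorem fst_map (e : OuterIso S T A B) {f : S.Face} (hf : f ∉ A) (i : Fin 3) :
    (e.map (f, i)).1 = (e.map (f, 0)).1 := by
  have hnext (i : Fin 3) : (e.map (f, i + 1)).1 = (e.map (f, i)).1 :=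
    (congrArg Prod.fst (e.map_next (f, i) hf) :)
  fin_cases i
  · rfl
  · exact hnext 0
  · exact (hnext 1).trans (hnext 0)

/-- The set to be deleted from the source if `B₁` is to be deleted from the target. -/
def pullback (e : OuterIso S T A B) (B₁ : Set T.Face) : Set S.Face :=
  {f | f ∈ A ∨ (e.map (f, 0)).1 ∈ B₁}

theorem finite_pullback (e : OuterIso S T A B) {B₁ : Set T.Face} (hA : A.Finite)
    (hB : B₁.Finite) : (e.pullback B₁).Finite := by
  have hnew : {f | f ∉ A ∧ (e.map (f, 0)).1 ∈ B₁}.Finite := by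
    refine Set.Finite.of_finite_image (f := fun f ↦ e.map (f, 0)) ?_ fun f hf g hg hfg ↦ ?_
    · refine (hB.prod (Set.finite_univ (α := Fin 3))).subset ?_
      rintro _ ⟨f, hf, rfl⟩
      exact ⟨hf.2, trivial⟩
    · have hinv := congrArg e.inv hfg
      dsimp only at hinv
      rw [e.inv_map _ hf.1, e.inv_map _ hg.1] at hinv
      exact congrArg Prod.fst hinv
  refine (hA.union hnew).subset fun f hf ↦ ?_
  by_cases h : f ∈ A
  · exact Or.inl h
  · exact Or.inr ⟨h, hf.resolve_left h⟩

/-- The restriction of an isomorphism that arises when the triangles in `B₁` are deleted as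
well. -/
def restrict (e : OuterIso S T A B) {B₁ : Set T.Face} (hB : B ⊆ B₁) :
    OuterIso S T (e.pullback B₁) B₁ :=
  have hA : ∀ {f : S.Face}, f ∉ e.pullback B₁ → f ∉ A := fun hf h ↦ hf (Or.inl h)
  have hB' : ∀ {f : T.Face}, f ∉ B₁ → f ∉ B := fun hf h ↦ hf (hB h)
  { map := e.map
    inv := e.inv
    map_outer := fun s hs h ↦ hs (Or.inr (e.fst_map (hA hs) s.2 ▸ h))
    inv_outer := by
      rintro t ht (h | h)
      · exact e.inv_outer t (hB' ht) h
      · rw [← e.fst_map (e.inv_outer t (hB' ht)) (e.inv t).2, Prod.mk.eta,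
          e.map_inv t (hB' ht)] at h
        exact ht h
    inv_map := fun s hs ↦ e.inv_map s (hA hs)
    map_inv := fun t ht ↦ e.map_inv t (hB' ht)
    map_next := fun s hs ↦ e.map_next s (hA hs)
    map_mate := fun s hs hm ↦ e.map_mate s (hA hs) (hA hm)
    inv_mate := fun t ht hm ↦ e.inv_mate t (hB' ht) (hB' hm) }

section Regular

variable {B : Set regular.Face}

theorem rotate_iterate_six (e : OuterIso S regular A B) {s : S.Side}
    (h : ∀ n, (S.rotate^[n] s).1 ∉ A) : S.rotate^[6] s = s :=
  (e.rotate_iterate_eq_iff h 6).2 (isPeriodicPt_regular_rotate _)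

theorem start_notMem_verticesOf_iff (e : OuterIso S regular A B) (s : S.Side) :
    S.start s ∉ S.verticesOf A ↔ ∀ n, (S.rotate^[n] s).1 ∉ A :=
  ⟨fun h n hn ↦ h ⟨_, hn, S.start_rotate_iterate n s⟩, fun h ↦
    (TriangleGluing.start_notMem_verticesOf_iff (by norm_num) (e.rotate_iterate_six h)).2 h⟩

theorem start_mem_verticesOf_iff (e : OuterIso S regular A B) {s : S.Side} (hs : s.1 ∉ A) :
    S.start s ∈ S.verticesOf A ↔ regular.start (e.map s) ∈ regular.verticesOf B := by
  rw [← not_iff_not, e.start_notMem_verticesOf_iff, e.forall_rotate_iterate_outer_iff hs,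
    TriangleGluing.start_notMem_verticesOf_iff (by norm_num) (isPeriodicPt_regular_rotate _)]

theorem degree_eq_six (e : OuterIso S regular A B) {v : S.Vertex} (hv : v ∉ S.verticesOf A) :
    S.degree v = 6 := by
  obtain ⟨s, rfl⟩ := S.start_surjective v
  have h := (e.start_notMem_verticesOf_iff s).1 hv
  rw [degree_start, e.minimalPeriod_rotate h, ← degree_start, regular_degree]

theorem exceptional_subset (e : OuterIso S regular A B) : S.exceptional ⊆ S.verticesOf A := by
  intro v hv
  by_contra h
  exact hv (e.degree_eq_six h)

end Regular

end OuterIso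

theorem IsoNearInfinity.exists_outerIso {T : TriangleGluing} [Nonempty T.Side]
    (h : IsoNearInfinity T regular) :
    ∃ (A : Set T.Face) (B : Set regular.Face), A.Finite ∧ B.Finite ∧
      Nonempty (OuterIso T regular A B) := by
  obtain ⟨A, B, hA, hB, φ, hnext | hnext, hmate⟩ := h
  · have : Nonempty regular.Side := ⟨regularBase 0⟩
    exact ⟨A, B, hA, hB, ⟨OuterIso.ofEquiv φ hnext hmate⟩⟩
  · have : Nonempty regular.Side := ⟨regularBase 0⟩
    have hinj : Function.Injective reflectFace := fun f g hfg ↦ congrArg reflectFace hfg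
    refine ⟨A, reflectFace ⁻¹' B, hA, hB.preimage hinj.injOn, ⟨OuterIso.ofEquiv
      (φ.trans ((reflectSide_involutive.toPerm _).subtypeEquiv fun s ↦ Iff.rfl))
      (fun s s' hs ↦ ?_) fun s s' ↦ ?_⟩⟩
    · change reflectSide (φ s').1 = _
      rw [hnext s s' hs, reflectSide_next_symm]
      rfl
    · refine (hmate s s').trans ?_
      change _ ↔ reflectSide (φ s').1 = regular.mate (reflectSide (φ s).1)
      rw [← reflectSide_mate, reflectSide_involutive.injective.eq_iff]

/-! ### Squares in the regular triangulation -/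

section Box

/-- The pair of lattice points joined by a side of the regular triangulation. -/
def ends (t : regular.Side) : (ℤ × ℤ) × (ℤ × ℤ) := (corner t, corner (regular.next t))

theorem ends_mate (t : regular.Side) : ends (regular.mate t) = (ends t).swap :=
  Prod.ext (corner_mate t) (corner_next_mate t)

theorem ends_injective : Function.Injective ends := by
  rintro ⟨⟨m, n, b⟩, i⟩ ⟨⟨m', n', b'⟩, i'⟩ h
  obtain ⟨h₀, h₁⟩ := Prod.ext_iff.1 h
  change regularCorner (m, n, b) i = regularCorner (m', n', b') i' at h₀
  change regularCorner (m, n, b) (i + 1) = regularCorner (m', n', b') (i' + 1) at h₁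
  obtain ⟨rfl, rfl, rfl, rfl⟩ : m = m' ∧ n = n' ∧ b = b' ∧ i = i' := by
    cases b <;> cases b' <;> fin_cases i <;> fin_cases i' <;>
      simp [regularCorner] at h₀ h₁ ⊢ <;> omega
  rfl

theorem extend_ends_swap {c : regular.Side → ℤ} (hc : ∀ t, c (regular.mate t) = -c t)
    (x : (ℤ × ℤ) × (ℤ × ℤ)) :
    Function.extend ends c 0 x.swap = -Function.extend ends c 0 x := by
  by_cases hx : x ∈ Set.range ends
  · obtain ⟨t, rfl⟩ := hx
    rw [← ends_mate, ends_injective.extend_apply, ends_injective.extend_apply, hc]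
  · have hswap : x.swap ∉ Set.range ends := by
      rintro ⟨t, ht⟩
      exact hx ⟨regular.mate t, by rw [ends_mate, ht, Prod.swap_swap]⟩
    rw [Function.extend_apply' _ _ _ hx, Function.extend_apply' _ _ _ hswap]
    rfl

/-- The triangles of the regular triangulation that lie in `square n`. -/
def box (n : ℕ) : Set regular.Face := {f | (-n ≤ f.1 ∧ f.1 < n) ∧ -n ≤ f.2.1 ∧ f.2.1 < n}

/-- The lattice points with coordinates of absolute value at most `n`. -/
def square (n : ℕ) : Set (ℤ × ℤ) := {x | (-n ≤ x.1 ∧ x.1 ≤ n) ∧ -n ≤ x.2 ∧ x.2 ≤ n}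

/-- The point of `square n` nearest to a given lattice point. -/
def clamp (n : ℕ) (x : ℤ × ℤ) : ℤ × ℤ := (max (-n) (min n x.1), max (-n) (min n x.2))

theorem mem_box {n : ℕ} {a b : ℤ} {c : Bool} :
    ((a, b, c) : ℤ × ℤ × Bool) ∈ box n ↔ (-n ≤ a ∧ a < n) ∧ -n ≤ b ∧ b < n := Iff.rfl

theorem mem_square {n : ℕ} {a b : ℤ} : (a, b) ∈ square n ↔ (-n ≤ a ∧ a ≤ n) ∧ -n ≤ b ∧ b ≤ n :=
  Iff.rfl

theorem box_mono : Monotone box := by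
  intro m n hmn f hf
  simp only [box, Set.mem_ofPred_eq] at hf ⊢
  omega

theorem corner_mem_square {n : ℕ} {t : (ℤ × ℤ × Bool) × Fin 3} (ht : t.1 ∈ box n) :
    corner t ∈ square n := by
  obtain ⟨⟨a, b, c⟩, i⟩ := t
  rw [mem_box] at ht
  cases c <;> fin_cases i <;> simp only [corner, regularCorner, mem_square] <;> omega

theorem clamp_eq_self {n : ℕ} {x : ℤ × ℤ} (hx : x ∈ square n) : clamp n x = x := by
  obtain ⟨a, b⟩ := x
  rw [mem_square] at hx
  simp only [clamp, Prod.mk.injEq]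
  omega

theorem clamp_mem_square (n : ℕ) (x : ℤ × ℤ) : clamp n x ∈ square n := by
  obtain ⟨a, b⟩ := x
  simp only [clamp, mem_square]
  omega

theorem mate_mem_box_succ {n : ℕ} {t : (ℤ × ℤ × Bool) × Fin 3} (ht : t.1 ∈ box n) :
    (regular.mate t).1 ∈ box (n + 1) := by
  obtain ⟨⟨a, b, c⟩, i⟩ := t
  rw [mem_box] at ht
  cases c <;> fin_cases i <;> refine mem_box.2 ?_ <;> omega

theorem clamp_corner_notMem_square {n : ℕ} {t : (ℤ × ℤ × Bool) × Fin 3} (ht : t.1 ∉ box (n + 1)) :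
    clamp (n + 1) (corner t) ∉ square n := by
  obtain ⟨⟨a, b, c⟩, i⟩ := t
  rw [mem_box] at ht
  cases c <;> fin_cases i <;> simp only [corner, regularCorner, clamp, mem_square] <;> omega

/-- The retraction `clamp` maps every triangle outside the box to a vertex or an edge. -/
theorem clamp_corner_eq_or_eq_or_eq {n : ℕ} {t : (ℤ × ℤ × Bool) × Fin 3} (ht : t.1 ∉ box n) :
    clamp n (corner t) = clamp n (corner (regular.next t)) ∨
      clamp n (corner (regular.next t)) = clamp n (corner (regular.next (regular.next t))) ∨
        clamp n (corner (regular.next (regular.next t))) = clamp n (corner t) := by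
  obtain ⟨⟨a, b, c⟩, i⟩ := t
  rw [mem_box] at ht
  cases c <;> fin_cases i <;>
    simp [corner, next, regularCorner, clamp] <;> omega

theorem max_min_add_one (n : ℕ) (p : ℤ) :
    ((-n ≤ p ∧ p < n) ∧ max (-n : ℤ) (min n p) = p ∧ max (-n : ℤ) (min n (p + 1)) = p + 1) ∨
      ¬ (-n ≤ p ∧ p < n) ∧ max (-n : ℤ) (min n (p + 1)) = max (-n : ℤ) (min n p) := by
  omega

theorem clamp_corner_eq_or_adjacent {n : ℕ} {t : (ℤ × ℤ × Bool) × Fin 3} (ht : t.1 ∉ box n) :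
    let x := clamp n (corner t)
    let y := clamp n (corner (regular.next t))
    x.1 = y.1 ∧ x.2 = y.2 ∨ (y.1 = x.1 + 1 ∨ x.1 = y.1 + 1) ∧ x.2 = y.2 ∨
      x.1 = y.1 ∧ (x.2 = y.2 + 1 ∨ y.2 = x.2 + 1) := by
  obtain ⟨⟨p, q, c⟩, i⟩ := t
  rw [mem_box] at ht
  have hp := max_min_add_one n p
  have hq := max_min_add_one n q
  cases c <;> fin_cases i <;>
    simp only [corner, next, regularCorner, clamp, Equiv.coe_fn_mk] <;> grind

theorem exists_ends_eq_of_fst {n : ℕ} (hn : 0 < n) {a b : ℤ} (ha : -n ≤ a ∧ a < n)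
    (hb : -n ≤ b ∧ b ≤ n) : ∃ t ∈ regular.sidesOf (box n), ends t = ((a, b), (a + 1, b)) := by
  refine ⟨((a, b, true), 0), ?_, rfl⟩
  change (a, b, true) ∈ box n ∨ (a, b - 1, false) ∈ box n
  rw [mem_box, mem_box]
  omega

theorem exists_ends_eq_of_snd {n : ℕ} (hn : 0 < n) {a b : ℤ} (ha : -n ≤ a ∧ a ≤ n)
    (hb : -n ≤ b ∧ b < n) : ∃ t ∈ regular.sidesOf (box n), ends t = ((a, b + 1), (a, b)) := by
  refine ⟨((a, b, true), 2), ?_, rfl⟩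
  change (a, b, true) ∈ box n ∨ (a - 1, b, false) ∈ box n
  rw [mem_box, mem_box]
  omega

theorem exists_ends_eq_swap {n : ℕ} {x y : ℤ × ℤ}
    (h : ∃ t ∈ regular.sidesOf (box n), ends t = (x, y)) :
    ∃ t ∈ regular.sidesOf (box n), ends t = (y, x) := by
  obtain ⟨t, ht, hxy⟩ := h
  exact ⟨regular.mate t, mate_mem_sidesOf.2 ht, by rw [ends_mate, hxy, Prod.swap_prod_mk]⟩

theorem clamp_corner_eq_or_exists_ends_eq {n : ℕ} (hn : 0 < n) {t : (ℤ × ℤ × Bool) × Fin 3}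
    (ht : t.1 ∉ box n) :
    clamp n (corner t) = clamp n (corner (regular.next t)) ∨
      ∃ u ∈ regular.sidesOf (box n),
        ends u = (clamp n (corner t), clamp n (corner (regular.next t))) := by
  have hx := clamp_mem_square n (corner t)
  have hy := clamp_mem_square n (corner (regular.next t))
  have hxy := clamp_corner_eq_or_adjacent ht
  generalize clamp n (corner t) = x at *
  generalize clamp n (corner (regular.next t)) = y at *
  obtain ⟨a, b⟩ := x
  obtain ⟨a', b'⟩ := y
  rw [mem_square] at hx hy
  dsimp only at hxy
  obtain ⟨rfl, rfl⟩ | ⟨rfl | rfl, rfl⟩ | ⟨rfl, rfl | rfl⟩ := hxy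
  · exact Or.inl rfl
  · exact Or.inr (exists_ends_eq_of_fst hn (by omega) hx.2)
  · exact Or.inr (exists_ends_eq_swap (exists_ends_eq_of_fst hn (by omega) hx.2))
  · exact Or.inr (exists_ends_eq_of_snd hn hx.1 (by omega))
  · exact Or.inr (exists_ends_eq_swap (exists_ends_eq_of_snd hn hx.1 (by omega)))

end Box

/-! ### Cores -/

/-- The topological properties of a disc that are used of a set of triangles: its vertices are
connected by its edges, and every integral cocycle on it is a coboundary. -/
structure IsAcyclic (T : TriangleGluing) (K : Set T.Face) : Prop where
  connected : ∀ Q : T.Vertex → Prop,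
    (∀ s ∈ T.sidesOf K, Q (T.start s) → Q (T.start (T.mate s))) →
      ∀ v ∈ T.verticesOf K, ∀ w ∈ T.verticesOf K, Q v → Q w
  exists_potential : ∀ c : T.Side → ℤ, (∀ s, c (T.mate s) = -c s) →
    (∀ s, s.1 ∈ K → c s + c (T.next s) + c (T.next (T.next s)) = 0) →
      ∃ ψ : T.Vertex → ℤ, ∀ s ∈ T.sidesOf K, c s = ψ (T.start (T.mate s)) - ψ (T.start s)

namespace OuterIso

variable {T : TriangleGluing} {A : Set T.Face} {n : ℕ} (e : OuterIso T regular A (box n))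

/-- The triangles that are deleted in `T`, or correspond to triangles in `box (n + 1)`. -/
def core : Set T.Face := e.pullback (box (n + 1))

/-- The restriction of an isomorphism to the complement of its core. -/
def coreIso : OuterIso T regular e.core (box (n + 1)) := e.restrict (box_mono n.le_succ)

theorem notMem_of_notMem_core {f : T.Face} (hf : f ∉ e.core) : f ∉ A := fun h ↦ hf (Or.inl h)

theorem map_notMem_box {s : T.Side} (hs : s.1 ∉ e.core) : (e.map s).1 ∉ box (n + 1) :=
  e.coreIso.map_outer s hs

theorem inv_mem_core {t : regular.Side} (ht : t.1 ∉ box n) (htn : t.1 ∈ box (n + 1)) :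
    (e.inv t).1 ∈ e.core := by
  by_contra h
  have hmap := e.map_notMem_box h
  rw [e.map_inv t ht] at hmap
  exact hmap htn

theorem mate_notMem {s : T.Side} (hs : s.1 ∉ e.core) : (T.mate s).1 ∉ A := by
  rw [e.mate_outer_iff (e.notMem_of_notMem_core hs)]
  intro h
  have hmate := mate_mem_box_succ h
  rw [regular.mate_mate] at hmate
  exact e.map_notMem_box hs hmate

theorem map_mate_of_notMem_core {s : T.Side} (hs : s.1 ∉ e.core) :
    e.map (T.mate s) = regular.mate (e.map s) :=
  e.map_mate s (e.notMem_of_notMem_core hs) (e.mate_notMem hs)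

/-- The vertex of the glued surface that corresponds to a lattice point. -/
def vertexAt (x : ℤ × ℤ) : T.Vertex := T.start (e.inv (regularBase x))

theorem notMem_box_of_corner {t : regular.Side} (ht : corner t ∉ square n) : t.1 ∉ box n :=
  fun h ↦ ht (corner_mem_square h)

theorem start_inv {t : regular.Side} (ht : corner t ∉ square n) :
    T.start (e.inv t) = e.vertexAt (corner t) := by
  obtain ⟨j, -, hj⟩ := exists_rotate_iterate_regularBase t
  have houter (k : ℕ) : (regular.rotate^[k] (regularBase (corner t))).1 ∉ box n := by
    apply notMem_box_of_corner
    rwa [corner_rotate_iterate, corner_regularBase]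
  have hinv : e.inv t = T.rotate^[j] (e.inv (regularBase (corner t))) :=
    (congrArg e.inv hj).symm.trans (e.symm.map_rotate_iterate houter j)
  rw [hinv, start_rotate_iterate, vertexAt]

theorem start_eq_vertexAt {s : T.Side} (hs : s.1 ∉ A) (h : corner (e.map s) ∉ square n) :
    T.start s = e.vertexAt (corner (e.map s)) := by
  rw [← e.start_inv h, e.inv_map s hs]

open Classical in
/-- The retraction of the vertices of the glued surface onto those of the core that is given by
`clamp` outside the core, as a function of a side at the vertex. -/
noncomputable def retract (s : T.Side) : T.Vertex :=
  if T.start s ∈ T.verticesOf e.core then T.start s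
  else e.vertexAt (clamp (n + 1) (corner (e.map s)))

theorem retract_of_mem {s : T.Side} (hs : T.start s ∈ T.verticesOf e.core) :
    e.retract s = T.start s := if_pos hs

theorem retract_of_notMem_core {s : T.Side} (hs : s.1 ∉ e.core) :
    e.retract s = e.vertexAt (clamp (n + 1) (corner (e.map s))) := by
  by_cases h : T.start s ∈ T.verticesOf e.core
  · have hmem := (e.coreIso.start_mem_verticesOf_iff hs).1 h
    obtain ⟨t, ht, hts⟩ := hmem
    have hcorner : corner (e.map s) ∈ square (n + 1) := by
      have hst : corner t = corner (e.map s) := regular_start_eq_start_iff.1 hts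
      exact hst ▸ corner_mem_square ht
    have hclamp := clamp_corner_notMem_square (e.map_notMem_box hs)
    rw [clamp_eq_self hcorner] at hclamp ⊢
    rw [e.retract_of_mem h, e.start_eq_vertexAt (e.notMem_of_notMem_core hs) hclamp]
  · exact if_neg h

theorem retract_mate (s : T.Side) : e.retract (T.mate s) = e.retract (T.next s) := by
  have hstart : T.start (T.next s) = T.start (T.mate s) := T.start_next s
  by_cases h : T.start (T.mate s) ∈ T.verticesOf e.core
  · rw [e.retract_of_mem h, e.retract_of_mem (hstart ▸ h), hstart]
  · have hm : (T.mate s).1 ∉ e.core := fun hm ↦ h ⟨_, hm, rfl⟩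
    have hs : s.1 ∉ e.core := fun hs ↦ h ⟨T.next s, hs, hstart⟩
    rw [e.retract_of_notMem_core hm, e.retract_of_notMem_core (s := T.next s) hs,
      e.map_mate_of_notMem_core hs, e.map_next s (e.notMem_of_notMem_core hs), corner_mate]

theorem retract_eq_or_exists_side (s : T.Side) :
    e.retract s = e.retract (T.next s) ∨
      ∃ t ∈ T.sidesOf e.core,
        T.start t = e.retract s ∧ T.start (T.mate t) = e.retract (T.next s) := by
  by_cases hs : s.1 ∈ e.core
  · refine Or.inr ⟨s, Or.inl hs, ?_, ?_⟩
    · exact (e.retract_of_mem ⟨s, hs, rfl⟩).symm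
    · rw [e.retract_of_mem ⟨T.next s, hs, rfl⟩, start_next]
  · have hnext := e.map_next s (e.notMem_of_notMem_core hs)
    have hbox := e.map_notMem_box hs
    have hx := clamp_corner_notMem_square hbox
    have hy := clamp_corner_notMem_square (t := regular.next (e.map s)) hbox
    rw [e.retract_of_notMem_core hs, e.retract_of_notMem_core (s := T.next s) hs, hnext]
    refine (clamp_corner_eq_or_exists_ends_eq n.succ_pos hbox).imp (congrArg _) ?_
    rintro ⟨u, hu, hends⟩
    obtain ⟨hux, huy⟩ := Prod.mk.inj hends
    rw [← corner_mate] at huy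
    rw [← hux] at hx ⊢
    rw [← huy] at hy ⊢
    have h₁ := notMem_box_of_corner hx
    have h₂ := notMem_box_of_corner hy
    have hmate := e.inv_mate u h₁ h₂
    refine ⟨e.inv u, ?_, e.start_inv hx, by rw [← hmate, e.start_inv hy]⟩
    exact hu.imp (e.inv_mem_core h₁) fun h ↦ hmate ▸ e.inv_mem_core h₂ h

theorem core_connected (hT : T.IsPlane) (Q : T.Vertex → Prop)
    (hQ : ∀ s ∈ T.sidesOf e.core, Q (T.start s) → Q (T.start (T.mate s))) :
    ∀ v ∈ T.verticesOf e.core, ∀ w ∈ T.verticesOf e.core, Q v → Q w := by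
  rintro _ ⟨s₀, hs₀, rfl⟩ _ ⟨s, hs, rfl⟩ h₀
  have hnext (s : T.Side) (h : Q (e.retract s)) : Q (e.retract (T.next s)) := by
    obtain heq | ⟨t, ht, h₁, h₂⟩ := e.retract_eq_or_exists_side s
    · rwa [← heq]
    · rw [← h₂]
      rw [← h₁] at h
      exact hQ t ht h
  have hmate (s : T.Side) (h : Q (e.retract s)) : Q (e.retract (T.mate s)) := by
    rw [retract_mate]
    exact hnext s h
  rw [← e.retract_of_mem ⟨s₀, hs₀, rfl⟩] at h₀
  rw [← e.retract_of_mem ⟨s, hs, rfl⟩]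
  exact hT.side_induction hnext hmate h₀ s

open Classical in
/-- The function on the sides of the regular triangulation that corresponds to `c` outside the box
and vanishes elsewhere. -/
noncomputable def transport (c : T.Side → ℤ) (t : regular.Side) : ℤ :=
  if t.1 ∉ box n ∧ (regular.mate t).1 ∉ box n then c (e.inv t) else 0

theorem transport_mate {c : T.Side → ℤ} (hc : ∀ s, c (T.mate s) = -c s) (t : regular.Side) :
    e.transport c (regular.mate t) = -e.transport c t := by
  unfold transport
  by_cases h : t.1 ∉ box n ∧ (regular.mate t).1 ∉ box n
  · rw [regular.mate_mate, if_pos h, if_pos h.symm, e.inv_mate t h.1 h.2, hc]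
  · rw [regular.mate_mate, if_neg h, if_neg fun h' ↦ h h'.symm, neg_zero]

theorem transport_map (c : T.Side → ℤ) {s : T.Side} (hs : s.1 ∉ e.core) :
    e.transport c (e.map s) = c s := by
  have hA := e.notMem_of_notMem_core hs
  have hbox := e.map_outer s hA
  have hmate := (e.mate_outer_iff hA).1 (e.mate_notMem hs)
  rw [transport, if_pos ⟨hbox, hmate⟩, e.inv_map s hA]

/-- The pullback of `c` under the retraction `clamp`: its value on a side outside the core. -/
noncomputable def clampCochain (c : T.Side → ℤ) (t : regular.Side) : ℤ :=
  Function.extend ends (e.transport c) 0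
    (clamp (n + 1) (corner t), clamp (n + 1) (corner (regular.next t)))

theorem clampCochain_mate {c : T.Side → ℤ} (hc : ∀ s, c (T.mate s) = -c s) (t : regular.Side) :
    e.clampCochain c (regular.mate t) = -e.clampCochain c t := by
  rw [clampCochain, corner_mate, corner_next_mate]
  exact extend_ends_swap (e.transport_mate hc) (_, _)

theorem clampCochain_closed {c : T.Side → ℤ} (hc : ∀ s, c (T.mate s) = -c s) {t : regular.Side}
    (ht : t.1 ∉ box (n + 1)) :
    e.clampCochain c t + e.clampCochain c (regular.next t) +
      e.clampCochain c (regular.next (regular.next t)) = 0 := by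
  unfold clampCochain
  rw [next_next_next]
  have hswap (x y : ℤ × ℤ) : Function.extend ends (e.transport c) 0 (y, x) =
      -Function.extend ends (e.transport c) 0 (x, y) :=
    extend_ends_swap (e.transport_mate hc) (x, y)
  have hself (x : ℤ × ℤ) : Function.extend ends (e.transport c) 0 (x, x) = 0 :=
    self_eq_neg.1 (hswap x x)
  obtain h | h | h := clamp_corner_eq_or_eq_or_eq ht
  · rw [h, hself, zero_add, hswap, neg_add_cancel]
  · rw [h, hself, add_zero, hswap, neg_add_cancel]
  · rw [h, hself, add_zero, hswap, neg_add_cancel]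

theorem clampCochain_map_of_boundary (c : T.Side → ℤ) {s : T.Side}
    (hs : s ∈ T.boundarySides e.core) : e.clampCochain c (e.map s) = c s := by
  obtain ⟨hs, hm⟩ := hs
  have hbox : (regular.mate (e.map s)).1 ∈ box (n + 1) := by
    by_contra h
    exact (e.coreIso.mate_outer_iff hs).2 h hm
  have hx : corner (e.map s) ∈ square (n + 1) := by
    rw [← corner_next_mate]
    exact corner_mem_square (t := regular.next (regular.mate (e.map s))) hbox
  have hy : corner (regular.next (e.map s)) ∈ square (n + 1) := by
    rw [← corner_mate]
    exact corner_mem_square hbox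
  rw [clampCochain, clamp_eq_self hx, clamp_eq_self hy, ← e.transport_map c hs]
  exact ends_injective.extend_apply _ _ _

theorem exists_cocycle_extension {c : T.Side → ℤ} (hanti : ∀ s, c (T.mate s) = -c s)
    (hclosed : ∀ s, s.1 ∈ e.core → c s + c (T.next s) + c (T.next (T.next s)) = 0) :
    ∃ c' : T.Side → ℤ, (∀ s, c' (T.mate s) = -c' s) ∧
      (∀ s, c' s + c' (T.next s) + c' (T.next (T.next s)) = 0) ∧
        ∀ s ∈ T.sidesOf e.core, c' s = c s := by
  classical
  let c' (s : T.Side) : ℤ := if s ∈ T.sidesOf e.core then c s else e.clampCochain c (e.map s)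
  have hin {s : T.Side} (hs : s ∈ T.sidesOf e.core) : c' s = c s := if_pos hs
  have hout {s : T.Side} (hs : s.1 ∉ e.core) : c' s = e.clampCochain c (e.map s) := by
    by_cases h : s ∈ T.sidesOf e.core
    · rw [hin h, e.clampCochain_map_of_boundary c ⟨hs, h.resolve_left hs⟩]
    · exact if_neg h
  refine ⟨c', fun s ↦ ?_, fun s ↦ ?_, fun s ↦ hin⟩
  · by_cases h : s ∈ T.sidesOf e.core
    · rw [hin h, hin (mate_mem_sidesOf.2 h), hanti]
    · have hs : s.1 ∉ e.core := fun hs ↦ h (Or.inl hs)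
      have hm : (T.mate s).1 ∉ e.core := fun hm ↦ h (Or.inr hm)
      rw [hout hs, hout hm, e.map_mate_of_notMem_core hs, e.clampCochain_mate hanti]
  · by_cases hs : s.1 ∈ e.core
    · rw [hin (Or.inl hs), hin (s := T.next s) (Or.inl hs),
        hin (s := T.next (T.next s)) (Or.inl hs), hclosed s hs]
    · have hA := e.notMem_of_notMem_core hs
      rw [hout hs, hout (s := T.next s) hs, hout (s := T.next (T.next s)) hs,
        e.map_next (T.next s) hA, e.map_next s hA,
        e.clampCochain_closed hanti (e.map_notMem_box hs)]

theorem isAcyclic_core (hT : T.IsPlane) : T.IsAcyclic e.core where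
  connected := e.core_connected hT
  exists_potential c hanti hclosed := by
    obtain ⟨c', hanti', hclosed', hc'⟩ := e.exists_cocycle_extension hanti hclosed
    obtain ⟨ψ, hψ⟩ := hT.exists_potential hanti' hclosed'
    exact ⟨ψ, fun s hs ↦ by rw [← hc' s hs, hψ]⟩

end OuterIso

theorem exists_subset_box {B : Set regular.Face} (hB : B.Finite) : ∃ n, B ⊆ box n := by
  obtain ⟨M, hM⟩ := (hB.image fun f : ℤ × ℤ × Bool ↦ max |f.1| |f.2.1|).bddAbove
  refine ⟨M.toNat + 1, fun f hf ↦ ?_⟩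
  have hmax := hM ⟨f, hf, rfl⟩
  have hfst := abs_le.1 ((le_max_left _ _).trans hmax)
  have hsnd := abs_le.1 ((le_max_right _ _).trans hmax)
  change (_ ≤ f.1 ∧ f.1 < _) ∧ _ ≤ f.2.1 ∧ f.2.1 < _
  push_cast
  omega

theorem finite_box (n : ℕ) : (box n).Finite := by
  have hprod := (Set.finite_Ico (-(n : ℤ)) n).prod
    ((Set.finite_Ico (-(n : ℤ)) n).prod (Set.finite_univ (α := Bool)))
  exact hprod.subset fun f hf ↦ ⟨hf.1, hf.2, trivial⟩

theorem IsPlane.nonempty_side {T : TriangleGluing} (hT : T.IsPlane) : Nonempty T.Side := by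
  obtain ⟨h⟩ := hT
  obtain ⟨⟨f, -⟩, -⟩ := Quot.exists_rep (h.symm 0)
  exact ⟨(f, 0)⟩

theorem IsPlane.exists_outerIso_box {T : TriangleGluing} (hT : T.IsPlane)
    (h : IsoNearInfinity T regular) :
    ∃ (n : ℕ) (K : Set T.Face), 0 < n ∧ K.Finite ∧ T.IsAcyclic K ∧
      Nonempty (OuterIso T regular K (box n)) := by
  have := hT.nonempty_side
  obtain ⟨A, B, hA, hB, ⟨e⟩⟩ := h.exists_outerIso
  obtain ⟨n, hn⟩ := exists_subset_box hB
  exact ⟨n + 1, _, n.succ_pos, (e.restrict hn).finite_pullback (e.finite_pullback hA (finite_box n))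
    (finite_box (n + 1)), (e.restrict hn).isAcyclic_core hT, ⟨(e.restrict hn).coreIso⟩⟩

/-! ### Counting -/

section Counting

variable {T : TriangleGluing} {K : Set T.Face}

theorem finite_sides (hK : K.Finite) : {s : T.Side | s.1 ∈ K}.Finite :=
  (hK.prod (Set.finite_univ (α := Fin 3))).subset fun _ hs ↦ ⟨hs, trivial⟩

theorem ncard_sides (K : Set T.Face) : {s : T.Side | s.1 ∈ K}.ncard = 3 * K.ncard := by
  have hprod : {s : T.Side | s.1 ∈ K} = K ×ˢ (Set.univ : Set (Fin 3)) := by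
    ext s
    simp
  rw [hprod, Set.ncard_prod, Set.ncard_univ, Nat.card_fin, mul_comm]

theorem finite_sides_mate (hK : K.Finite) : {s : T.Side | (T.mate s).1 ∈ K}.Finite :=
  (finite_sides hK).preimage (f := T.mate) (mate_injective T).injOn

theorem finite_boundarySides (hK : K.Finite) : (T.boundarySides K).Finite :=
  (finite_sides_mate hK).subset fun _ hs ↦ hs.2

theorem finite_sidesOf (hK : K.Finite) : (T.sidesOf K).Finite :=
  (finite_sides hK).union (finite_sides_mate hK)

theorem finite_verticesOf (hK : K.Finite) : (T.verticesOf K).Finite :=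
  (finite_sides hK).image _

theorem ncard_sidesOf (hK : K.Finite) :
    (T.sidesOf K).ncard = 3 * K.ncard + (T.boundarySides K).ncard := by
  have hunion : T.sidesOf K = {s | s.1 ∈ K} ∪ T.boundarySides K := by
    ext s
    by_cases h : s.1 ∈ K <;> simp [sidesOf, boundarySides, h]
  have hdisj : Disjoint {s : T.Side | s.1 ∈ K} (T.boundarySides K) :=
    Set.disjoint_left.2 fun s h h' ↦ h'.1 h
  rw [hunion, Set.ncard_union_eq hdisj (finite_sides hK) (finite_boundarySides hK), ncard_sides]

theorem setOf_start_mem_verticesOf (T : TriangleGluing) (K : Set T.Face) :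
    {s | T.start s ∈ T.verticesOf K} = {s | s.1 ∈ K} ∪ T.collarSides K := by
  ext s
  by_cases hs : s.1 ∈ K
  · exact iff_of_true ⟨s, hs, rfl⟩ (Or.inl hs)
  · exact ⟨fun h ↦ Or.inr ⟨hs, h⟩, fun h ↦ (h.resolve_left hs).2⟩

theorem ncard_start_mem_verticesOf (hK : K.Finite) (hc : (T.collarSides K).Finite) :
    {s | T.start s ∈ T.verticesOf K}.ncard = 3 * K.ncard + (T.collarSides K).ncard := by
  have hdisj : Disjoint {s : T.Side | s.1 ∈ K} (T.collarSides K) :=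
    Set.disjoint_left.2 fun s h h' ↦ h'.1 h
  rw [setOf_start_mem_verticesOf, Set.ncard_union_eq hdisj (finite_sides hK) hc, ncard_sides]

theorem encard_start_mem {W : Set T.Vertex} (hW : W.Finite) {d : ℕ∞}
    (h : ∀ v ∈ W, T.degree v = d) : {s | T.start s ∈ W}.encard = d * W.encard := by
  induction W, hW using Set.Finite.induction_on with
  | empty => simp
  | @insert v W hv _ ih =>
    have hunion : {s | T.start s ∈ insert v W} = {s | T.start s = v} ∪ {s | T.start s ∈ W} := rfl
    have hdisj : Disjoint {s | T.start s = v} {s | T.start s ∈ W} :=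
      Set.disjoint_left.2 fun s hs hsW ↦ hv (hs ▸ hsW)
    rw [hunion, Set.encard_union_eq hdisj, Set.encard_insert_of_notMem hv,
      ih fun w hw ↦ h w (Or.inr hw), mul_add, mul_one, add_comm]
    exact congrArg _ (h v (Or.inl rfl))

theorem ncard_start_mem {W : Set T.Vertex} (hW : W.Finite) (h : ∀ v ∈ W, T.degree v = 6) :
    {s | T.start s ∈ W}.ncard = 6 * W.ncard := by
  rw [Set.ncard, encard_start_mem hW h, ENat.toNat_mul]
  rfl

theorem ncard_Ico_neg (n : ℕ) : (Set.Ico (-(n : ℤ)) n).ncard = 2 * n := by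
  rw [← Finset.coe_Ico, Set.ncard_coe_finset, Int.card_Ico]
  omega

theorem ncard_box (n : ℕ) : (box n).ncard = 8 * n ^ 2 := by
  have hprod : box n =
      (Set.Ico (-(n : ℤ)) n ×ˢ (Set.Ico (-(n : ℤ)) n ×ˢ Set.univ) : Set (ℤ × ℤ × Bool)) := by
    ext f
    exact and_congr Iff.rfl (and_iff_left trivial).symm
  refine (congrArg Set.ncard hprod).trans ?_
  change (Set.Ico (-(n : ℤ)) n ×ˢ (Set.Ico (-(n : ℤ)) n ×ˢ (Set.univ : Set Bool))).ncard = _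
  rw [Set.ncard_prod, Set.ncard_prod, ncard_Ico_neg, Set.ncard_univ, Nat.card_eq_fintype_card,
    Fintype.card_bool]
  ring

theorem ncard_square (n : ℕ) : (square n).ncard = (2 * n + 1) ^ 2 := by
  have hIcc : (Set.Icc (-(n : ℤ)) n).ncard = 2 * n + 1 := by
    rw [← Finset.coe_Icc, Set.ncard_coe_finset, Int.card_Icc]
    omega
  have hprod : square n = Set.Icc (-(n : ℤ)) n ×ˢ Set.Icc (-(n : ℤ)) n := rfl
  rw [hprod, Set.ncard_prod, hIcc, sq]

theorem exists_corner_eq {n : ℕ} (hn : 0 < n) {x : ℤ × ℤ} (hx : x ∈ square n) :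
    ∃ t : regular.Side, t.1 ∈ box n ∧ corner t = x := by
  obtain ⟨a, b⟩ := x
  rw [mem_square] at hx
  by_cases ha : a = n <;> by_cases hb : b = n
  · exact ⟨((a - 1, b - 1, false), 0), mem_box.2 (by omega), by simp [corner, regularCorner]⟩
  · exact ⟨((a - 1, b, true), 1), mem_box.2 (by omega), by simp [corner, regularCorner]⟩
  · exact ⟨((a, b - 1, true), 2), mem_box.2 (by omega), by simp [corner, regularCorner]⟩
  · exact ⟨((a, b, true), 0), mem_box.2 (by omega), rfl⟩

theorem verticesOf_box {n : ℕ} (hn : 0 < n) :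
    regular.verticesOf (box n) = (fun x ↦ regular.start (regularBase x)) '' square n := by
  ext v
  constructor
  · rintro ⟨t, ht, rfl⟩
    exact ⟨corner t, corner_mem_square ht, regular_start_eq_start_iff.2 rfl⟩
  · rintro ⟨x, hx, rfl⟩
    obtain ⟨t, ht, rfl⟩ := exists_corner_eq hn hx
    exact ⟨t, ht, regular_start_eq_start_iff.2 rfl⟩

theorem ncard_verticesOf_box {n : ℕ} (hn : 0 < n) :
    (regular.verticesOf (box n)).ncard = (2 * n + 1) ^ 2 := by
  rw [verticesOf_box hn, Set.ncard_image_of_injective, ncard_square]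
  exact fun x y hxy ↦ regular_start_eq_start_iff.1 hxy

theorem finite_collarSides_box (n : ℕ) : (regular.collarSides (box n)).Finite := by
  have hV := finite_verticesOf (finite_box n)
  have hfin : {s | regular.start s ∈ regular.verticesOf (box n)}.Finite := by
    rw [← Set.encard_lt_top_iff, encard_start_mem hV fun v _ ↦ regular_degree v]
    exact WithTop.mul_lt_top (by decide) hV.encard_lt_top
  exact hfin.subset fun s hs ↦ hs.2

theorem ncard_collarSides_box {n : ℕ} (hn : 0 < n) :
    (regular.collarSides (box n)).ncard = 24 * n + 6 := by
  have hcount := ncard_start_mem_verticesOf (finite_box n) (finite_collarSides_box n)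
  rw [ncard_start_mem (finite_verticesOf (finite_box n)) fun v _ ↦ regular_degree v,
    ncard_verticesOf_box hn, ncard_box] at hcount
  linarith

/-- The sides that are glued to the four sides of `square n` from outside, each of the four being
parametrized by one lattice coordinate. -/
def outerSide (n : ℕ) : ℤ × Fin 4 → (ℤ × ℤ × Bool) × Fin 3
  | (a, 0) => ((a, -n - 1, false), 0)
  | (a, 1) => ((a, n, true), 0)
  | (a, 2) => ((-n - 1, a, false), 2)
  | (a, 3) => ((n, a, true), 2)

theorem outerSide_injective (n : ℕ) : Function.Injective (outerSide n) := by
  rintro ⟨a, i⟩ ⟨b, j⟩ hij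
  fin_cases i <;> fin_cases j <;> simp [outerSide] at hij ⊢ <;> omega

theorem boundarySides_box (n : ℕ) :
    regular.boundarySides (box n) =
      outerSide n '' (Set.Ico (-(n : ℤ)) n ×ˢ (Set.univ : Set (Fin 4))) := by
  ext t
  constructor
  · obtain ⟨⟨a, b, c⟩, i⟩ := t
    rintro ⟨ht, hm⟩
    cases c <;> fin_cases i <;> replace ht := mt mem_box.2 ht <;> replace hm := mem_box.1 hm
    · exact ⟨(a, 0), ⟨hm.1, trivial⟩, by rw [show b = -n - 1 by omega]; rfl⟩
    · exact absurd hm ht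
    · exact ⟨(b, 2), ⟨hm.2, trivial⟩, by rw [show a = -n - 1 by omega]; rfl⟩
    · exact ⟨(a, 1), ⟨hm.1, trivial⟩, by rw [show b = n by omega]; rfl⟩
    · exact absurd hm ht
    · exact ⟨(b, 3), ⟨hm.2, trivial⟩, by rw [show a = n by omega]; rfl⟩
  · rintro ⟨⟨a, j⟩, ⟨⟨h₁, h₂⟩, -⟩, rfl⟩
    dsimp only at h₁ h₂
    fin_cases j <;> exact ⟨fun h ↦ by have := mem_box.1 h; omega, mem_box.2 (by omega)⟩

theorem ncard_boundarySides_box (n : ℕ) : (regular.boundarySides (box n)).ncard = 8 * n := by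
  refine (congrArg Set.ncard (boundarySides_box n)).trans ?_
  refine (Set.ncard_image_of_injective _ (outerSide_injective n)).trans ?_
  rw [Set.ncard_prod, ncard_Ico_neg, Set.ncard_univ, Nat.card_fin]
  ring

end Counting

namespace OuterIso

variable {S T : TriangleGluing} {K : Set S.Face} {L : Set T.Face}

theorem injOn_map (e : OuterIso S T K L) : Set.InjOn e.map {s | s.1 ∉ K} :=
  Set.LeftInvOn.injOn fun s ↦ e.inv_map s

theorem image_map_boundarySides (e : OuterIso S T K L) :
    e.map '' S.boundarySides K = T.boundarySides L := by
  ext t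
  constructor
  · rintro ⟨s, ⟨hs, hm⟩, rfl⟩
    exact ⟨e.map_outer s hs, not_not.1 (mt (e.mate_outer_iff hs).2 (not_not.2 hm))⟩
  · rintro ⟨ht, hm⟩
    exact ⟨e.inv t, ⟨e.inv_outer t ht,
      not_not.1 (mt (e.symm.mate_outer_iff ht).2 (not_not.2 hm))⟩, e.map_inv t ht⟩

theorem ncard_boundarySides (e : OuterIso S T K L) :
    (S.boundarySides K).ncard = (T.boundarySides L).ncard := by
  rw [← e.image_map_boundarySides, Set.InjOn.ncard_image (e.injOn_map.mono fun s hs ↦ hs.1)]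

variable {T : TriangleGluing} {K : Set T.Face} {L : Set regular.Face}

theorem image_map_collarSides (e : OuterIso T regular K L) :
    e.map '' T.collarSides K = regular.collarSides L := by
  ext t
  constructor
  · rintro ⟨s, ⟨hs, hv⟩, rfl⟩
    exact ⟨e.map_outer s hs, (e.start_mem_verticesOf_iff hs).1 hv⟩
  · rintro ⟨ht, hv⟩
    rw [← e.map_inv t ht] at hv
    exact ⟨e.inv t, ⟨e.inv_outer t ht, (e.start_mem_verticesOf_iff (e.inv_outer t ht)).2 hv⟩,
      e.map_inv t ht⟩

theorem ncard_collarSides (e : OuterIso T regular K L) :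
    (T.collarSides K).ncard = (regular.collarSides L).ncard := by
  rw [← e.image_map_collarSides, Set.InjOn.ncard_image (e.injOn_map.mono fun s hs ↦ hs.1)]

theorem finite_collarSides (e : OuterIso T regular K L) (h : (regular.collarSides L).Finite) :
    (T.collarSides K).Finite := by
  rw [← e.image_map_collarSides] at h
  exact h.of_finite_image (e.injOn_map.mono fun s hs ↦ hs.1)

variable {n : ℕ}

theorem finite_start_mem_verticesOf (hK : K.Finite) (e : OuterIso T regular K (box n)) :
    {s | T.start s ∈ T.verticesOf K}.Finite := by
  rw [setOf_start_mem_verticesOf]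
  exact (finite_sides hK).union (e.finite_collarSides (finite_collarSides_box n))

theorem finite_start_mem_exceptional (hK : K.Finite) (e : OuterIso T regular K (box n)) :
    {s | T.start s ∈ T.exceptional}.Finite :=
  (e.finite_start_mem_verticesOf hK).subset fun _ hs ↦ e.exceptional_subset hs

theorem ncard_start_mem_exceptional (hK : K.Finite) (hn : 0 < n)
    (e : OuterIso T regular K (box n)) :
    {s | T.start s ∈ T.exceptional}.ncard + 6 * (T.verticesOf K).ncard =
      3 * K.ncard + 24 * n + 6 + 6 * T.exceptional.ncard := by
  have hV := finite_verticesOf hK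
  have hexc := e.exceptional_subset
  have hsplit : {s | T.start s ∈ T.verticesOf K} =
      {s | T.start s ∈ T.verticesOf K \ T.exceptional} ∪ {s | T.start s ∈ T.exceptional} := by
    have hset := Set.sdiff_union_of_subset hexc
    exact (congrArg (T.start ⁻¹' ·) hset).symm
  have hdisj : Disjoint {s | T.start s ∈ T.verticesOf K \ T.exceptional}
      {s | T.start s ∈ T.exceptional} := Set.disjoint_left.2 fun s h h' ↦ h.2 h'
  have hordinary : {s | T.start s ∈ T.verticesOf K \ T.exceptional}.ncard =
      6 * (T.verticesOf K \ T.exceptional).ncard :=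
    ncard_start_mem (hV.subset Set.sdiff_subset) fun v hv ↦ not_not.1 hv.2
  have hcount := ncard_start_mem_verticesOf hK (e.finite_collarSides (finite_collarSides_box n))
  rw [e.ncard_collarSides, ncard_collarSides_box hn, hsplit, Set.ncard_union_eq hdisj
    ((e.finite_start_mem_verticesOf hK).subset fun s hs ↦ hs.1) (e.finite_start_mem_exceptional hK),
    hordinary] at hcount
  have hsub := Set.ncard_sdiff_add_ncard_of_subset hexc hV
  omega

end OuterIso

/-! ### Functions on edges -/

section EdgeCochain

variable (T : TriangleGluing) (K : Set T.Face) {k : Type*} [CommRing k] (ε : k)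

/-- The functions on the edges of `K`, encoded as functions on the sides with values `f s` and
`ε * f s` on the two sides of an edge: `ε = 1` for functions on unoriented edges, and `ε = -1` for
functions on oriented edges. -/
def edgeCochain : Submodule k (T.Side → k) where
  carrier := {f | (∀ s, f (T.mate s) = ε * f s) ∧ ∀ s ∉ T.sidesOf K, f s = 0}
  add_mem' {f g} hf hg :=
    ⟨fun s ↦ by rw [Pi.add_apply, Pi.add_apply, hf.1, hg.1, mul_add],
      fun s hs ↦ by rw [Pi.add_apply, hf.2 s hs, hg.2 s hs, add_zero]⟩
  zero_mem' := ⟨fun _ ↦ (mul_zero ε).symm, fun _ _ ↦ rfl⟩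
  smul_mem' c f hf :=
    ⟨fun s ↦ by rw [Pi.smul_apply, Pi.smul_apply, hf.1, mul_smul_comm],
      fun s hs ↦ by rw [Pi.smul_apply, hf.2 s hs, smul_zero]⟩

/-- A choice of one of the two sides of each edge of `K`. -/
def edgeReps : Set T.Side := {s ∈ T.sidesOf K | WellOrderingRel s (T.mate s)}

variable {T K ε}

theorem mem_edgeReps_or_mate_mem {s : T.Side} (hs : s ∈ T.sidesOf K) :
    s ∈ T.edgeReps K ∨ T.mate s ∈ T.edgeReps K := by
  rcases trichotomous_of WellOrderingRel s (T.mate s) with h | h | h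
  · exact Or.inl ⟨hs, h⟩
  · exact absurd h.symm (T.mate_ne s)
  · exact Or.inr ⟨mate_mem_sidesOf.2 hs, by rwa [T.mate_mate]⟩

theorem mate_notMem_edgeReps {s : T.Side} (hs : s ∈ T.edgeReps K) : T.mate s ∉ T.edgeReps K := by
  intro h
  have hlt := h.2
  rw [T.mate_mate] at hlt
  exact asymm_of WellOrderingRel hs.2 hlt

theorem two_mul_ncard_edgeReps (hK : K.Finite) :
    2 * (T.edgeReps K).ncard = (T.sidesOf K).ncard := by
  have hfin : (T.edgeReps K).Finite := (finite_sidesOf hK).subset fun s hs ↦ hs.1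
  have hunion : T.sidesOf K = T.edgeReps K ∪ T.mate '' T.edgeReps K := by
    ext s
    constructor
    · exact fun hs ↦ (mem_edgeReps_or_mate_mem hs).imp_right fun h ↦ ⟨_, h, T.mate_mate s⟩
    · rintro (hs | ⟨s, hs, rfl⟩)
      exacts [hs.1, mate_mem_sidesOf.2 hs.1]
  have hdisj : Disjoint (T.edgeReps K) (T.mate '' T.edgeReps K) := by
    rw [Set.disjoint_right]
    rintro _ ⟨s, hs, rfl⟩
    exact mate_notMem_edgeReps hs
  rw [hunion, Set.ncard_union_eq hdisj hfin (hfin.image _),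
    Set.ncard_image_of_injective _ (mate_injective T), two_mul]

theorem exists_edgeCochain_extending (hε : ε * ε = 1) (g : T.Side → k) :
    ∃ f ∈ T.edgeCochain K ε, ∀ s ∈ T.edgeReps K, f s = g s := by
  classical
  refine ⟨fun s ↦ if s ∈ T.edgeReps K then g s else
    if T.mate s ∈ T.edgeReps K then ε * g (T.mate s) else 0, ⟨fun s ↦ ?_, fun s hs ↦ ?_⟩,
    fun s hs ↦ if_pos hs⟩
  · by_cases hs : s ∈ T.edgeReps K
    · simp only [T.mate_mate, hs, mate_notMem_edgeReps hs, if_true, if_false]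
    · by_cases hm : T.mate s ∈ T.edgeReps K
      · simp only [hs, hm, if_true, if_false]
        rw [← mul_assoc, hε, one_mul]
      · simp only [T.mate_mate, hs, hm, if_false, mul_zero]
  · have hm : T.mate s ∉ T.edgeReps K := fun h ↦ hs (mate_mem_sidesOf.1 h.1)
    exact (if_neg fun h ↦ hs h.1).trans (if_neg hm)

theorem edgeCochain_eq_zero {f : T.Side → k} (hf : f ∈ T.edgeCochain K ε)
    (h : ∀ s ∈ T.edgeReps K, f s = 0) : f = 0 := by
  funext s
  by_cases hs : s ∈ T.sidesOf K
  · rcases mem_edgeReps_or_mate_mem hs with hs | hs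
    · exact h s hs
    · rw [← T.mate_mate s, hf.1, h _ hs, mul_zero, Pi.zero_apply]
  · exact hf.2 s hs

variable (K) in
/-- A function on the edges of `K` is determined by its values on the chosen sides, which are
arbitrary. -/
noncomputable def edgeCochainEquiv (hε : ε * ε = 1) :
    T.edgeCochain K ε ≃ₗ[k] (T.edgeReps K → k) :=
  LinearEquiv.ofBijective ((LinearMap.funLeft k k Subtype.val).comp (T.edgeCochain K ε).subtype)
    ⟨by
      rw [injective_iff_map_eq_zero]
      exact fun f hf ↦ Subtype.ext (edgeCochain_eq_zero f.2 fun s hs ↦ congrFun hf ⟨s, hs⟩),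
    fun g ↦ by
      obtain ⟨f, hf, hfg⟩ := exists_edgeCochain_extending (K := K) hε
        (Function.extend Subtype.val g 0)
      exact ⟨⟨f, hf⟩, funext fun s ↦ (hfg s s.2).trans
        (Subtype.val_injective.extend_apply g 0 s)⟩⟩

theorem finite_edgeCochain (hK : K.Finite) (hε : ε * ε = 1) :
    Module.Finite k (T.edgeCochain K ε) := by
  have : Finite (T.edgeReps K) := ((finite_sidesOf hK).subset fun s hs ↦ hs.1).to_subtype
  exact Module.Finite.equiv (edgeCochainEquiv K hε).symm

theorem two_mul_finrank_edgeCochain [Nontrivial k] (hK : K.Finite) (hε : ε * ε = 1) :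
    2 * Module.finrank k (T.edgeCochain K ε) = (T.sidesOf K).ncard := by
  rw [(edgeCochainEquiv K hε).finrank_eq,
    finrank_pi_coe_set ((finite_sidesOf hK).subset fun s hs ↦ hs.1), two_mul_ncard_edgeReps hK]

end EdgeCochain

/-! ### Euler's inequality -/

section Euler

variable (T : TriangleGluing) (K : Set T.Face)

open Classical in
/-- The differences of a function on the vertices of `K` along the oriented edges of `K`. -/
noncomputable def coboundary : (T.verticesOf K → ℤ) →ₗ[ℤ] T.edgeCochain K (-1 : ℤ) where
  toFun ψ := ⟨fun s ↦ if h : s ∈ T.sidesOf K then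
      ψ ⟨T.start (T.mate s), start_mem_verticesOf (mate_mem_sidesOf.2 h)⟩ -
        ψ ⟨T.start s, start_mem_verticesOf h⟩ else 0, by
    refine ⟨fun s ↦ ?_, fun s hs ↦ dif_neg hs⟩
    by_cases hs : s ∈ T.sidesOf K
    · simp only [hs, mate_mem_sidesOf, T.mate_mate, dif_pos]
      ring
    · simp only [hs, mate_mem_sidesOf, dif_neg, not_false_eq_true, mul_zero]⟩
  map_add' ψ ψ' := by
    ext s
    by_cases hs : s ∈ T.sidesOf K <;> simp [hs]
    ring
  map_smul' a ψ := by
    ext s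
    by_cases hs : s ∈ T.sidesOf K <;> simp [hs]
    ring

/-- The sum of a function on oriented edges around each triangle of `K`. -/
def circulation : T.edgeCochain K (-1 : ℤ) →ₗ[ℤ] (K → ℤ) where
  toFun c f := ∑ i, c.1 (f.1, i)
  map_add' _ _ := funext fun _ ↦ Finset.sum_add_distrib
  map_smul' _ _ := funext fun _ ↦ (Finset.mul_sum _ _ _).symm

variable {T K}

theorem add_next_add_next_next (c : T.Side → ℤ) (s : T.Side) :
    c s + c (T.next s) + c (T.next (T.next s)) = ∑ i, c (s.1, i) := by
  obtain ⟨f, i⟩ := s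
  rw [Fin.sum_univ_three]
  fin_cases i <;> simp [next] <;> ring

theorem IsAcyclic.ker_circulation_le (hT : T.IsAcyclic K) :
    (T.circulation K).ker ≤ (T.coboundary K).range := by
  intro c hc
  have hsum (f : K) : ∑ i, c.1 (f.1, i) = 0 := congrFun (LinearMap.mem_ker.1 hc) f
  obtain ⟨ψ, hψ⟩ := hT.exists_potential c.1 (fun s ↦ by rw [c.2.1, neg_one_mul]) fun s hs ↦
    (add_next_add_next_next c.1 s).trans (hsum ⟨s.1, hs⟩)
  refine ⟨fun v ↦ ψ v, Subtype.ext (funext fun s ↦ ?_)⟩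
  by_cases hs : s ∈ T.sidesOf K
  · exact (dif_pos hs).trans (hψ s hs).symm
  · exact (dif_neg hs).trans (c.2.2 s hs).symm

theorem one_le_finrank_ker_coboundary (hK : K.Finite) (hne : K.Nonempty) :
    1 ≤ Module.finrank ℤ (T.coboundary K).ker := by
  have := (finite_verticesOf hK).to_subtype
  obtain ⟨f, hf⟩ := hne
  have hconst : (fun _ ↦ 1 : T.verticesOf K → ℤ) ∈ (T.coboundary K).ker := by
    rw [LinearMap.mem_ker]
    ext s
    simp [coboundary]
  refine Module.finrank_pos_iff_exists_ne_zero.2 ⟨⟨_, hconst⟩, fun h ↦ ?_⟩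
  have hone := congrFun (congrArg Subtype.val h) ⟨T.start (f, 0), (f, 0), hf, rfl⟩
  exact one_ne_zero hone

theorem IsAcyclic.ncard_sidesOf_add_two_le (hT : T.IsAcyclic K) (hK : K.Finite)
    (hne : K.Nonempty) :
    (T.sidesOf K).ncard + 2 ≤ 2 * ((T.verticesOf K).ncard + K.ncard) := by
  have := hK.to_subtype
  have := (finite_verticesOf hK).to_subtype
  have hε : (-1 : ℤ) * -1 = 1 := by norm_num
  have := finite_edgeCochain hK hε
  have hdim := finrank_add_finrank_ker_le _ _ hT.ker_circulation_le
  rw [finrank_pi_coe_set (finite_verticesOf hK), finrank_pi_coe_set hK] at hdim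
  have hker := one_le_finrank_ker_coboundary hK hne
  have hsides := two_mul_finrank_edgeCochain hK hε
  omega

end Euler

/-! ### Developments -/

section Development

variable {T : TriangleGluing} {k : Type*} [CommRing k] {ζ a : k} {P : T.Side → k}

/-- `P s` is the position of a fixed point of the plane in the coordinate in which the side `s` of
an equilateral triangle goes from `0` to `a`, where `ζ` is a primitive sixth root of unity.
For `a = 1` this describes the fixed point of the holonomy of a developing map, and `a = 0` is the
linearized condition, satisfied by differences. -/
structure IsDevelopment (T : TriangleGluing) (ζ a : k) (P : T.Side → k) : Prop where
  next : ∀ s, P (T.next s) = ζ * (a - P s)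
  mate : ∀ s, P (T.mate s) = a - P s

theorem pow_mul_rotate_iterate (hP : ∀ s, P (T.next s) = ζ * (a - P s)) (t : T.Side) (n : ℕ) :
    ζ ^ n * P (T.rotate^[n] t) = P t + ∑ j ∈ Finset.range n, ζ ^ (j + 1) *
      (P (T.mate (T.next.symm (T.rotate^[j] t))) + P (T.next.symm (T.rotate^[j] t)) - a) := by
  induction n with
  | zero => simp
  | succ n ih =>
    have hnext := hP (T.next.symm (T.rotate^[n] t))
    rw [Equiv.apply_symm_apply] at hnext
    rw [Finset.sum_range_succ, ← add_assoc, ← ih, Function.iterate_succ_apply', rotate_apply]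
    linear_combination (-ζ ^ n) * hnext

namespace IsDevelopment

theorem pow_mul_rotate_iterate (hP : IsDevelopment T ζ a P) (t : T.Side) (n : ℕ) :
    ζ ^ n * P (T.rotate^[n] t) = P t := by
  rw [TriangleGluing.pow_mul_rotate_iterate hP.next, Finset.sum_eq_zero, add_zero]
  intro j _
  rw [hP.mate, sub_add_cancel, sub_self, mul_zero]

theorem eq_zero_of_isPeriodicPt [NoZeroDivisors k] (hP : IsDevelopment T ζ a P) {t : T.Side}
    {d : ℕ} (ht : Function.IsPeriodicPt T.rotate d t) (hd : ζ ^ d ≠ 1) : P t = 0 := by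
  have hrot := hP.pow_mul_rotate_iterate t d
  rw [ht.eq] at hrot
  have hmul : (ζ ^ d - 1) * P t = 0 := by rw [sub_mul, one_mul, hrot, sub_self]
  exact (mul_eq_zero.1 hmul).resolve_left (sub_ne_zero.2 hd)

/-- Turning by the angle `π` and then passing to the other end of the side is a translation. -/
theorem exists_translation (hP : IsDevelopment T ζ a P) (hζ : ζ ^ 3 = -1) :
    ∃ W : T.Side → T.Side, Function.Injective W ∧ ∀ s, P (W s) = P s + a := by
  refine ⟨fun s ↦ T.mate (T.rotate^[3] s),
    (mate_injective T).comp (T.rotate.injective.iterate 3), fun s ↦ ?_⟩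
  have hrot := hP.pow_mul_rotate_iterate s 3
  rw [hζ] at hrot
  rw [hP.mate]
  linear_combination hrot

end IsDevelopment

end Development

/-! ### The triangular lattice -/

section Lattice

variable {k : Type*} [CommRing k] (ζ : k)

/-- The position of a lattice point in the plane, when `ζ` is a primitive sixth root of unity. -/
def latticePos (x : ℤ × ℤ) : k := x.1 + x.2 * ζ

/-- The inverse of the direction of a side of the regular triangulation: the directions of the sides
of an upward triangle are the cube roots of unity, those of a downward triangle their negatives. -/
def invDir (t : (ℤ × ℤ × Bool) × Fin 3) : k := (if t.1.2.2 then 1 else -1) * (-ζ) ^ (t.2 : ℕ)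

/-- The position of the point `q` in the coordinate in which a side goes from `0` to `1`. -/
def latticeDev (q : k) (t : regular.Side) : k := (q - latticePos ζ (corner t)) * invDir ζ t

variable {ζ}

theorem sq_eq_sub_one_of_isPrimitiveRoot [NoZeroDivisors k]
    (h : IsPrimitiveRoot ζ 6) : ζ ^ 2 = ζ - 1 := by
  have hcube : ζ ^ 3 - 1 ≠ 0 :=
    sub_ne_zero.2 (h.pow_ne_one_of_pos_of_lt (by norm_num) (by norm_num))
  have hsq : ζ ^ 2 - 1 ≠ 0 :=
    sub_ne_zero.2 (h.pow_ne_one_of_pos_of_lt (by norm_num) (by norm_num))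
  have hmul : (ζ ^ 3 - 1) * (ζ ^ 2 - 1) * (ζ ^ 2 - ζ + 1) = 0 := by
    linear_combination (ζ - 1) * h.pow_eq_one
  have hzero := (mul_eq_zero.1 hmul).resolve_left (mul_ne_zero hcube hsq)
  linear_combination hzero

theorem latticePos_injective [CharZero k] (hζ : ζ ^ 2 = ζ - 1) :
    Function.Injective (latticePos ζ) := by
  rintro ⟨a, b⟩ ⟨a', b'⟩ h
  rw [latticePos, latticePos] at h
  have hnorm : (((a - a') ^ 2 + (a - a') * (b - b') + (b - b') ^ 2 : ℤ) : k) = 0 := by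
    push_cast
    linear_combination ((a - a' : k) + (b - b') * (1 - ζ)) * h + (b - b' : k) ^ 2 * hζ
  rw [Int.cast_eq_zero] at hnorm
  have ha : a - a' = 0 := by nlinarith [sq_nonneg (a - a'), sq_nonneg (a - a' + 2 * (b - b'))]
  have hb : b - b' = 0 := by nlinarith [sq_nonneg (b - b'), sq_nonneg (b - b' + 2 * (a - a'))]
  rw [sub_eq_zero.1 ha, sub_eq_zero.1 hb]

theorem neg_pow_three_eq_one (hζ : ζ ^ 2 = ζ - 1) : (-ζ) ^ 3 = 1 := by
  linear_combination (-ζ - 1) * hζ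

theorem pow_six_eq_one (hζ : ζ ^ 2 = ζ - 1) : ζ ^ 6 = 1 := by
  rw [← Even.neg_pow (by decide), pow_mul (-ζ) 3 2, neg_pow_three_eq_one hζ, one_pow]

theorem neg_pow_fin_add_one (hζ : ζ ^ 2 = ζ - 1) (i : Fin 3) :
    (-ζ) ^ ((i + 1 : Fin 3) : ℕ) = -ζ * (-ζ) ^ (i : ℕ) := by
  rw [← pow_succ']
  fin_cases i
  · rfl
  · rfl
  · exact (pow_zero _).trans (neg_pow_three_eq_one hζ).symm

theorem isUnit_invDir (hζ : ζ ^ 2 = ζ - 1) (t : (ℤ × ℤ × Bool) × Fin 3) :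
    IsUnit (invDir ζ t) := by
  have hunit : IsUnit (-ζ) := IsUnit.of_mul_eq_one (ζ - 1) (by linear_combination -hζ)
  refine IsUnit.mul ?_ (hunit.pow _)
  split_ifs
  exacts [isUnit_one, isUnit_one.neg]

theorem invDir_next (hζ : ζ ^ 2 = ζ - 1) (t : regular.Side) :
    invDir ζ (regular.next t) = -ζ * invDir ζ t := by
  change (if t.1.2.2 then 1 else -1) * (-ζ) ^ ((t.2 + 1 : Fin 3) : ℕ) = _
  rw [neg_pow_fin_add_one hζ, mul_left_comm]
  rfl

theorem invDir_regularMate (t : (ℤ × ℤ × Bool) × Fin 3) :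
    invDir ζ (regularMate t) = -invDir ζ t := by
  obtain ⟨⟨m, n, b⟩, i⟩ := t
  cases b <;> fin_cases i <;> simp [invDir, regularMate]

theorem invDir_mate (t : regular.Side) : invDir ζ (regular.mate t) = -invDir ζ t :=
  invDir_regularMate t

theorem latticePos_regularCorner (hζ : ζ ^ 2 = ζ - 1) (t : (ℤ × ℤ × Bool) × Fin 3) :
    (latticePos ζ (regularCorner t.1 (t.2 + 1)) - latticePos ζ (regularCorner t.1 t.2)) *
      invDir ζ t = 1 := by
  obtain ⟨⟨m, n, b⟩, i⟩ := t
  cases b <;> fin_cases i <;> simp [invDir, latticePos, regularCorner] <;>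
    first | ring1 | linear_combination -hζ | linear_combination (-ζ - 1) * hζ

theorem isDevelopment_latticeDev (hζ : ζ ^ 2 = ζ - 1) (q : k) :
    IsDevelopment regular ζ 1 (latticeDev ζ q) where
  next t := by
    have hside : (latticePos ζ (corner (regular.next t)) - latticePos ζ (corner t)) *
      invDir ζ t = 1 := latticePos_regularCorner hζ t
    rw [latticeDev, latticeDev, invDir_next hζ]
    linear_combination ζ * hside
  mate t := by
    have hside : (latticePos ζ (corner (regular.next t)) - latticePos ζ (corner t)) *
      invDir ζ t = 1 := latticePos_regularCorner hζ t
    rw [latticeDev, latticeDev, invDir_mate, corner_mate]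
    linear_combination hside

theorem regularCorner_injective (b : Bool) (i : Fin 3) :
    Function.Injective fun x : ℤ × ℤ ↦ regularCorner (x.1, x.2, b) i := by
  rintro ⟨m, n⟩ ⟨m', n'⟩ h
  cases b <;> fin_cases i <;> simpa [regularCorner] using h

theorem encard_latticeDev_eq_le (hζ : ζ ^ 2 = ζ - 1) (hinj : Function.Injective (latticePos ζ))
    (q x : k) : {t | latticeDev ζ q t = x}.encard ≤ 6 := by
  have hinjOn : Set.InjOn (fun t : regular.Side ↦ (t.1.2.2, t.2)) {t | latticeDev ζ q t = x} := by
    rintro ⟨⟨m, n, b⟩, i⟩ h₁ ⟨⟨m', n', b'⟩, i'⟩ h₂ h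
    obtain ⟨rfl, rfl⟩ := Prod.mk.inj h
    have hdev := (isUnit_invDir hζ _).mul_right_cancel (h₁.trans (Eq.symm h₂))
    obtain ⟨rfl, rfl⟩ := Prod.mk.inj (regularCorner_injective _ _ (hinj (sub_right_inj.1 hdev)))
    rfl
  rw [← hinjOn.encard_image]
  refine (Set.encard_le_encard (Set.subset_univ _)).trans ?_
  rw [Set.encard_univ]
  norm_num

end Lattice

/-! ### Closing up around the ordinary vertices -/

section VertexDefect

variable (T : TriangleGluing) (K : Set T.Face) {k : Type*} [CommRing k] (ζ : k)

/-- The vertices of degree `6` of the triangles in `K`. -/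
def ordinaryVertices : Set T.Vertex := T.verticesOf K \ T.exceptional

/-- A choice of a side that starts at a given vertex. -/
noncomputable def chosenSide (v : T.Vertex) : T.Side := Function.surjInv T.start_surjective v

variable {T} in
/-- The weighted sum of a function on sides over the sides that end where `t` starts: the weights
are such that it vanishes on the failure of a rotation equivariant function to be compatible with
the gluing, see `vertexSum_eq_zero`. -/
def vertexSum (t : T.Side) : (T.Side → k) →ₗ[k] k :=
  ∑ j ∈ Finset.range 6, ζ ^ (j + 1) • LinearMap.proj (T.next.symm (T.rotate^[j] t))

/-- The obstruction for a function on edges to come from a function on triangles, given by one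
condition at each ordinary vertex. -/
noncomputable def vertexDefect : T.edgeCochain K (1 : k) →ₗ[k] (T.ordinaryVertices K → k) :=
  (LinearMap.pi fun v : T.ordinaryVertices K ↦ vertexSum ζ (T.chosenSide v)).comp
    (T.edgeCochain K 1).subtype

variable {T K ζ}

theorem start_chosenSide (v : T.Vertex) : T.start (T.chosenSide v) = v :=
  Function.surjInv_eq T.start_surjective v

theorem minimalPeriod_chosenSide {v : T.Vertex} (hv : v ∉ T.exceptional) :
    Function.minimalPeriod T.rotate (T.chosenSide v) = 6 := by
  rw [← degree_start_eq_coe_iff (by norm_num), start_chosenSide]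
  exact not_not.1 hv

theorem vertexSum_apply (t : T.Side) (f : T.Side → k) : vertexSum ζ t f =
    ∑ j ∈ Finset.range 6, ζ ^ (j + 1) * f (T.next.symm (T.rotate^[j] t)) := by
  simp only [vertexSum, LinearMap.sum_apply, LinearMap.smul_apply, LinearMap.proj_apply,
    smul_eq_mul]

theorem vertexSum_eq_zero {a : k} {P : T.Side → k} (hP : ∀ s, P (T.next s) = ζ * (a - P s))
    (hζ : ζ ^ 6 = 1) {t : T.Side} (ht : T.rotate^[6] t = t) :
    vertexSum ζ t (fun s ↦ P (T.mate s) + P s - a) = 0 := by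
  have hsum := pow_mul_rotate_iterate hP t 6
  rw [ht, hζ, one_mul] at hsum
  rw [vertexSum_apply]
  exact left_eq_add.1 hsum

theorem vertexDefect_eq_zero {a : k} {P : T.Side → k} (hP : ∀ s, P (T.next s) = ζ * (a - P s))
    (hζ : ζ ^ 6 = 1) {f : T.edgeCochain K (1 : k)}
    (hf : ∀ s, (f : T.Side → k) s = P (T.mate s) + P s - a) : T.vertexDefect K ζ f = 0 := by
  funext v
  have hiter : T.rotate^[6] (T.chosenSide v) = T.chosenSide v :=
    minimalPeriod_chosenSide v.2.2 ▸ Function.iterate_minimalPeriod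
  change vertexSum ζ (T.chosenSide v) f = 0
  rw [funext hf, vertexSum_eq_zero hP hζ hiter]

theorem vertexSum_indicator_eq_zero {s t : T.Side} (h : T.start t ≠ T.start (T.mate s)) :
    vertexSum ζ t (Set.indicator {s} 1) = 0 := by
  rw [vertexSum_apply]
  refine Finset.sum_eq_zero fun j _ ↦ ?_
  rw [Set.indicator_of_notMem, mul_zero]
  intro hj
  rw [Set.mem_singleton_iff, Equiv.symm_apply_eq] at hj
  rw [← start_rotate_iterate T j t, hj, start_next] at h
  exact h rfl

theorem exists_vertexSum_indicator {s t : T.Side} (h : T.start t = T.start (T.mate s))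
    (ht : Function.minimalPeriod T.rotate t = 6) :
    ∃ i : ℕ, vertexSum ζ t (Set.indicator {s} 1) = ζ ^ i := by
  have hper : T.rotate^[6] t = t := ht ▸ Function.iterate_minimalPeriod
  obtain ⟨i, hi, hit⟩ := exists_rotate_iterate_eq (by norm_num) hper
    ((T.start_next s).trans h.symm)
  refine ⟨i + 1, ?_⟩
  rw [vertexSum_apply, Finset.sum_eq_single_of_mem i (Finset.mem_range.2 hi)]
  · rw [hit, Equiv.symm_apply_apply, Set.indicator_of_mem (Set.mem_singleton s),
      Pi.one_apply, mul_one]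
  · intro j hj hji
    rw [Set.indicator_of_notMem, mul_zero]
    intro hjs
    rw [Set.mem_singleton_iff, Equiv.symm_apply_eq, ← hit] at hjs
    exact hji (Function.iterate_injOn_Iio_minimalPeriod
      (ht ▸ Finset.mem_range.1 hj) (ht ▸ hi) hjs)

theorem exists_isUnit_vertexSum_indicator (hζ : IsUnit ζ) (s : T.Side) :
    ∃ a : k, IsUnit a ∧ ∀ v ∉ T.exceptional, vertexSum ζ (T.chosenSide v) (Set.indicator {s} 1) =
      a * Set.indicator {T.start (T.mate s)} 1 v := by
  have hne {v : T.Vertex} (hv : v ≠ T.start (T.mate s)) (a : k) :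
      vertexSum ζ (T.chosenSide v) (Set.indicator {s} 1) =
        a * Set.indicator {T.start (T.mate s)} 1 v := by
    rw [Set.indicator_of_notMem (s := {T.start (T.mate s)}) hv, mul_zero]
    exact vertexSum_indicator_eq_zero (by rwa [start_chosenSide])
  by_cases hs : T.start (T.mate s) ∈ T.exceptional
  · exact ⟨1, isUnit_one, fun v hv ↦ hne (ne_of_mem_of_not_mem hs hv).symm 1⟩
  · obtain ⟨i, hi⟩ := exists_vertexSum_indicator (ζ := ζ)
      (start_chosenSide (T.start (T.mate s))) (minimalPeriod_chosenSide hs)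
    refine ⟨ζ ^ i, hζ.pow i, fun v _ ↦ ?_⟩
    by_cases h : v = T.start (T.mate s)
    · rw [h, hi, Set.indicator_of_mem (Set.mem_singleton _), Pi.one_apply, mul_one]
    · exact hne h _

theorem edgeIndicator_mem_edgeCochain {s : T.Side} (hs : s ∈ T.sidesOf K) :
    Set.indicator {s} 1 + Set.indicator {T.mate s} 1 ∈ T.edgeCochain K (1 : k) := by
  classical
  refine ⟨fun t ↦ ?_, fun t ht ↦ ?_⟩
  · have hmate : T.mate t = s ↔ t = T.mate s :=
      ⟨fun h ↦ by rw [← h, T.mate_mate], fun h ↦ by rw [h, T.mate_mate]⟩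
    simp only [Pi.add_apply, Set.indicator_apply, Set.mem_singleton_iff, hmate,
      (mate_injective T).eq_iff, one_mul]
    exact add_comm _ _
  · have hts : t ∉ ({s} : Set T.Side) := fun h ↦ ht (h ▸ hs)
    have htm : t ∉ ({T.mate s} : Set T.Side) := fun h ↦ ht (h ▸ mate_mem_sidesOf.2 hs)
    rw [Pi.add_apply, Set.indicator_of_notMem hts, Set.indicator_of_notMem htm, add_zero]

/-- Since an edge indicator has image a combination, with invertible coefficients, of the indicators
of its two ends, the image contains the indicator of one end if it contains that of the other;
and the indicator of an exceptional vertex is `0` on the ordinary vertices. -/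
theorem IsAcyclic.vertexDefect_surjective (hT : T.IsAcyclic K) (hK : K.Finite) (hζ : IsUnit ζ)
    {v₀ : T.Vertex} (hv₀ : v₀ ∈ T.verticesOf K) (hexc : v₀ ∈ T.exceptional) :
    Function.Surjective (T.vertexDefect K ζ) := by
  classical
  let δ (v : T.Vertex) : T.ordinaryVertices K → k := fun w ↦ Set.indicator {v} 1 w.1
  have hspread : ∀ s ∈ T.sidesOf K, δ (T.start s) ∈ (T.vertexDefect K ζ).range →
      δ (T.start (T.mate s)) ∈ (T.vertexDefect K ζ).range := by
    intro s hs hstart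
    obtain ⟨a, ha, hsa⟩ := exists_isUnit_vertexSum_indicator hζ s
    obtain ⟨b, -, hsb⟩ := exists_isUnit_vertexSum_indicator hζ (T.mate s)
    rw [T.mate_mate] at hsb
    have himage : T.vertexDefect K ζ ⟨_, edgeIndicator_mem_edgeCochain hs⟩ =
        a • δ (T.start (T.mate s)) + b • δ (T.start s) := funext fun w ↦
      ((vertexSum ζ (T.chosenSide w)).map_add _ _).trans
        (congrArg₂ (· + ·) (hsa w w.2.2) (hsb w w.2.2))
    rw [← Submodule.smul_mem_iff_of_isUnit _ ha, ← Submodule.add_mem_iff_left _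
      (Submodule.smul_mem _ b hstart), ← himage]
    exact LinearMap.mem_range_self _ _
  have hzero : δ v₀ ∈ (T.vertexDefect K ζ).range := by
    have : δ v₀ = 0 := funext fun w ↦
      Set.indicator_of_notMem (s := {v₀}) (a := w.1) (fun h : w.1 = v₀ ↦ w.2.2 (by rwa [h])) 1
    exact this ▸ Submodule.zero_mem _
  have : Fintype (T.ordinaryVertices K) := ((finite_verticesOf hK).subset Set.sdiff_subset).fintype
  rw [← LinearMap.range_eq_top, eq_top_iff]
  intro f _
  rw [pi_eq_sum_univ' f]
  refine Submodule.sum_mem _ fun w _ ↦ Submodule.smul_mem _ _ ?_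
  have hw : δ w.1 ∈ (T.vertexDefect K ζ).range :=
    hT.connected (fun v ↦ δ v ∈ (T.vertexDefect K ζ).range) hspread v₀ hv₀ w.1 w.2.1 hzero
  convert hw using 1
  funext u
  simp [δ, Set.indicator_apply, Pi.single_apply, Subtype.ext_iff]

end VertexDefect

/-! ### Extending the development over the core -/

theorem mateDefect_mem_edgeCochain {k : Type*} [CommRing k] {T : TriangleGluing} {K : Set T.Face}
    {a : k} {f : T.Side → k} (hf : ∀ s ∉ T.sidesOf K, f (T.mate s) = a - f s) :
    (fun s ↦ f (T.mate s) + f s - a) ∈ T.edgeCochain K (1 : k) := by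
  refine ⟨fun s ↦ ?_, fun s hs ↦ ?_⟩
  · beta_reduce
    rw [T.mate_mate, one_mul, add_comm]
  · beta_reduce
    rw [hf s hs, sub_add_cancel, sub_self]

namespace OuterIso

variable {T : TriangleGluing} {K : Set T.Face} {L : Set regular.Face}

section CommRing

variable {k : Type*} [CommRing k] {ζ : k}

open Classical in
/-- The functions `x` on sides with `x (T.next s) = -ζ * x s` that outside `K` are a constant
multiple of the inverse direction of sides: these are the possible changes of a development over
the triangles, by a free value in each triangle of `K` and a common translation outside. -/
noncomputable def faceCochain (e : OuterIso T regular K L) (ζ : k) :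
    ((K → k) × k) →ₗ[k] (T.Side → k) :=
  LinearMap.pi fun s ↦ if h : s.1 ∈ K then
    (-ζ) ^ (s.2 : ℕ) • (LinearMap.proj (⟨s.1, h⟩ : K)).comp (LinearMap.fst k (K → k) k)
  else invDir ζ (e.map s) • LinearMap.snd k (K → k) k

theorem faceCochain_of_mem (e : OuterIso T regular K L) {s : T.Side} (hs : s.1 ∈ K)
    (x : (K → k) × k) : e.faceCochain ζ x s = (-ζ) ^ (s.2 : ℕ) * x.1 ⟨s.1, hs⟩ := by
  rw [faceCochain, LinearMap.pi_apply, dif_pos hs]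
  rfl

theorem faceCochain_of_notMem (e : OuterIso T regular K L) {s : T.Side} (hs : s.1 ∉ K)
    (x : (K → k) × k) : e.faceCochain ζ x s = invDir ζ (e.map s) * x.2 := by
  rw [faceCochain, LinearMap.pi_apply, dif_neg hs]
  rfl

theorem faceCochain_next (e : OuterIso T regular K L) (hζ : ζ ^ 2 = ζ - 1) (x : (K → k) × k)
    (s : T.Side) : e.faceCochain ζ x (T.next s) = -ζ * e.faceCochain ζ x s := by
  by_cases hs : s.1 ∈ K
  · rw [e.faceCochain_of_mem hs, e.faceCochain_of_mem (s := T.next s) hs, ← mul_assoc,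
      ← neg_pow_fin_add_one hζ]
    rfl
  · rw [e.faceCochain_of_notMem hs, e.faceCochain_of_notMem (s := T.next s) hs, e.map_next s hs,
      invDir_next hζ, mul_assoc]

theorem faceCochain_mate (e : OuterIso T regular K L) (x : (K → k) × k) {s : T.Side}
    (hs : s ∉ T.sidesOf K) : e.faceCochain ζ x (T.mate s) = -e.faceCochain ζ x s := by
  obtain ⟨h, hm⟩ := not_or.1 hs
  rw [e.faceCochain_of_notMem h, e.faceCochain_of_notMem hm, e.map_mate s h hm, invDir_mate,
    neg_mul]

/-- The failure of a function on triangles to be compatible with the gluing. -/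
noncomputable def edgeDefect (e : OuterIso T regular K L) (ζ : k) :
    ((K → k) × k) →ₗ[k] T.edgeCochain K (1 : k) :=
  ((LinearMap.funLeft k k T.mate + LinearMap.id).comp (e.faceCochain ζ)).codRestrict _ fun x ↦ by
    convert mateDefect_mem_edgeCochain (a := (0 : k)) (f := e.faceCochain ζ x) fun s hs ↦ ?_
    · exact (sub_zero _).symm
    · rw [e.faceCochain_mate x hs, zero_sub]

theorem edgeDefect_apply (e : OuterIso T regular K L) (x : (K → k) × k) (s : T.Side) :
    (e.edgeDefect ζ x : T.Side → k) s = e.faceCochain ζ x (T.mate s) + e.faceCochain ζ x s :=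
  rfl

theorem isDevelopment_faceCochain (e : OuterIso T regular K L) (hζ : ζ ^ 2 = ζ - 1)
    {x : (K → k) × k} (hx : e.edgeDefect ζ x = 0) : IsDevelopment T ζ 0 (e.faceCochain ζ x) where
  next s := by rw [e.faceCochain_next hζ, zero_sub, mul_neg, neg_mul]
  mate s := by
    rw [zero_sub, ← add_eq_zero_iff_eq_neg, ← e.edgeDefect_apply, hx]
    rfl

theorem faceCochain_injective (e : OuterIso T regular K L) (hζ : ζ ^ 2 = ζ - 1) {s₁ : T.Side}
    (hs₁ : s₁.1 ∉ K) : Function.Injective (e.faceCochain ζ) := by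
  rw [injective_iff_map_eq_zero]
  intro x hx
  refine Prod.ext (funext fun f ↦ ?_) ?_
  · have hf := e.faceCochain_of_mem (ζ := ζ) (s := (f.1, 0)) f.2 x
    rw [hx, Pi.zero_apply] at hf
    simpa using hf.symm
  · have hs := e.faceCochain_of_notMem (ζ := ζ) hs₁ x
    rw [hx, Pi.zero_apply] at hs
    exact (isUnit_invDir hζ _).mul_right_eq_zero.1 hs.symm

/-- An element of the kernel is a flat section on the plane; it vanishes at `t₀`, where the
holonomy is not trivial, and thus everywhere. -/
theorem edgeDefect_injective [NoZeroDivisors k] (hT : T.IsPlane) (e : OuterIso T regular K L)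
    (hζ : ζ ^ 2 = ζ - 1) {s₁ t₀ : T.Side} (hs₁ : s₁.1 ∉ K) {d : ℕ}
    (ht₀ : Function.IsPeriodicPt T.rotate d t₀) (hd : ζ ^ d ≠ 1) :
    Function.Injective (e.edgeDefect ζ) := by
  rw [injective_iff_map_eq_zero]
  intro x hx
  have hdev := e.isDevelopment_faceCochain hζ hx
  refine (injective_iff_map_eq_zero _).1 (e.faceCochain_injective hζ hs₁) x (funext ?_)
  refine hT.side_induction (fun s hs ↦ ?_) (fun s hs ↦ ?_) (hdev.eq_zero_of_isPeriodicPt ht₀ hd)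
  · rw [hdev.next, hs, Pi.zero_apply, sub_zero, mul_zero]
    rfl
  · rw [hdev.mate, hs, Pi.zero_apply, sub_zero]
    rfl

theorem vertexDefect_edgeDefect (e : OuterIso T regular K L) (hζ : ζ ^ 2 = ζ - 1)
    (x : (K → k) × k) : T.vertexDefect K ζ (e.edgeDefect ζ x) = 0 := by
  refine vertexDefect_eq_zero (a := 0) (P := e.faceCochain ζ x) (fun s ↦ ?_) (pow_six_eq_one hζ)
    fun s ↦ ?_
  · rw [e.faceCochain_next hζ, zero_sub, mul_neg, neg_mul]
  · rw [sub_zero, e.edgeDefect_apply]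

open Classical in
/-- The function on sides that outside `K` is the development of the lattice with base point `0`,
and that on the triangles of `K` is that of a fixed triangle. -/
noncomputable def initialDev (e : OuterIso T regular K L) (ζ : k) (s : T.Side) : k :=
  latticeDev ζ 0 (if s.1 ∈ K then ((0, 0, true), s.2) else e.map s)

theorem initialDev_of_notMem (e : OuterIso T regular K L) {s : T.Side} (hs : s.1 ∉ K) :
    e.initialDev ζ s = latticeDev ζ 0 (e.map s) := by
  rw [initialDev, if_neg hs]

theorem initialDev_next (e : OuterIso T regular K L) (hζ : ζ ^ 2 = ζ - 1) (s : T.Side) :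
    e.initialDev ζ (T.next s) = ζ * (1 - e.initialDev ζ s) := by
  have hnext := (isDevelopment_latticeDev hζ 0).next
  by_cases hs : s.1 ∈ K
  · rw [initialDev, initialDev, if_pos hs, if_pos (show (T.next s).1 ∈ K from hs)]
    exact hnext ((0, 0, true), s.2)
  · rw [e.initialDev_of_notMem hs, e.initialDev_of_notMem (s := T.next s) hs,
      e.map_next s hs, hnext]

theorem initialDev_mate (e : OuterIso T regular K L) (hζ : ζ ^ 2 = ζ - 1) {s : T.Side}
    (hs : s ∉ T.sidesOf K) : e.initialDev ζ (T.mate s) = 1 - e.initialDev ζ s := by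
  obtain ⟨h, hm⟩ := not_or.1 hs
  rw [e.initialDev_of_notMem h, e.initialDev_of_notMem hm, e.map_mate s h hm,
    (isDevelopment_latticeDev hζ 0).mate]

theorem exists_isDevelopment (e : OuterIso T regular K L) (hζ : ζ ^ 2 = ζ - 1)
    (hexact : (e.edgeDefect ζ).range = (T.vertexDefect K ζ).ker) :
    ∃ (q : k) (P : T.Side → k), IsDevelopment T ζ 1 P ∧
      ∀ s, s.1 ∉ K → P s = latticeDev ζ q (e.map s) := by
  let z : T.edgeCochain K (1 : k) :=
    ⟨_, mateDefect_mem_edgeCochain fun s hs ↦ e.initialDev_mate hζ hs⟩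
  have hz : z ∈ (T.vertexDefect K ζ).ker :=
    vertexDefect_eq_zero (e.initialDev_next hζ) (pow_six_eq_one hζ) fun s ↦ rfl
  rw [← hexact] at hz
  obtain ⟨x, hx⟩ := hz
  have hxz (s : T.Side) : e.faceCochain ζ x (T.mate s) + e.faceCochain ζ x s =
      e.initialDev ζ (T.mate s) + e.initialDev ζ s - 1 := by
    rw [← e.edgeDefect_apply, hx]
  refine ⟨-x.2, e.initialDev ζ - e.faceCochain ζ x, ⟨fun s ↦ ?_, fun s ↦ ?_⟩, fun s hs ↦ ?_⟩
  · rw [Pi.sub_apply, Pi.sub_apply, e.initialDev_next hζ, e.faceCochain_next hζ]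
    ring
  · rw [Pi.sub_apply, Pi.sub_apply]
    linear_combination -hxz s
  · rw [Pi.sub_apply, e.initialDev_of_notMem hs, e.faceCochain_of_notMem hs, latticeDev, latticeDev]
    ring

end CommRing

theorem range_edgeDefect_eq_ker {k : Type*} [Field k] {ζ : k} (hT : T.IsPlane)
    (hacyclic : T.IsAcyclic K) (hK : K.Finite) (e : OuterIso T regular K L)
    (htwo : T.exceptional.encard = 2) (hζ : ζ ^ 2 = ζ - 1) {s₁ t₀ : T.Side} (hs₁ : s₁.1 ∉ K)
    (hexc : T.start t₀ ∈ T.exceptional) {d : ℕ} (ht₀ : Function.IsPeriodicPt T.rotate d t₀)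
    (hd : ζ ^ d ≠ 1) :
    (e.edgeDefect ζ).range = (T.vertexDefect K ζ).ker ∧
      (T.sidesOf K).ncard + 2 = 2 * ((T.verticesOf K).ncard + K.ncard) := by
  have := hK.to_subtype
  obtain ⟨s, hs, -⟩ := e.exceptional_subset hexc
  have hKne : K.Nonempty := ⟨s.1, hs⟩
  have hV := finite_verticesOf hK
  have hordinary : (T.ordinaryVertices K).Finite := hV.subset Set.sdiff_subset
  have := hordinary.to_subtype
  have := finite_edgeCochain (ε := (1 : k)) hK (one_mul 1)
  have hζunit : IsUnit ζ := IsUnit.of_pow_eq_one (pow_six_eq_one hζ) (by norm_num)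
  have hsurj := hacyclic.vertexDefect_surjective hK hζunit (e.exceptional_subset hexc) hexc
  have hinj := e.edgeDefect_injective hT hζ hs₁ ht₀ hd
  have hE := two_mul_finrank_edgeCochain (ε := (1 : k)) hK (one_mul 1)
  have hM : Module.finrank k ((K → k) × k) = K.ncard + 1 := by
    rw [Module.finrank_prod, finrank_pi_coe_set hK, Module.finrank_self]
  have hP : Module.finrank k (T.ordinaryVertices K → k) + 2 = (T.verticesOf K).ncard := by
    rw [finrank_pi_coe_set hordinary, ← Set.ncard_sdiff_add_ncard_of_subset e.exceptional_subset hV,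
      Set.ncard_def T.exceptional, htwo]
    rfl
  have heuler := hacyclic.ncard_sidesOf_add_two_le hK hKne
  have hle : (e.edgeDefect ζ).range ≤ (T.vertexDefect K ζ).ker := by
    rintro _ ⟨x, rfl⟩
    exact e.vertexDefect_edgeDefect hζ x
  have hexact := range_eq_ker_of_finrank_le hinj hsurj hle (by omega)
  exact ⟨hexact.1, by omega⟩

end OuterIso

/-- Translating the solutions of `P s = x` far away from `K` keeps their number, and there at most
six sides of the lattice have a given value. -/
theorem IsDevelopment.encard_eq_le {k : Type*} [CommRing k] [CharZero k] {ζ : k}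
    {T : TriangleGluing} {K : Set T.Face} {L : Set regular.Face} {P : T.Side → k}
    (hP : IsDevelopment T ζ 1 P) (hK : K.Finite) (e : OuterIso T regular K L)
    (hζ : ζ ^ 2 = ζ - 1) {q : k}
    (hout : ∀ s, s.1 ∉ K → P s = latticeDev ζ q (e.map s)) (x : k) :
    {s | P s = x}.encard ≤ 6 := by
  obtain ⟨W, hW, hPW⟩ := hP.exists_translation (by linear_combination (ζ + 1) * hζ)
  have hiter (m : ℕ) (s : T.Side) : P (W^[m] s) = P s + m := by
    induction m with
    | zero => rw [Function.iterate_zero_apply, Nat.cast_zero, add_zero]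
    | succ m ih => rw [Function.iterate_succ_apply', hPW, ih, Nat.cast_succ, add_assoc]
  obtain ⟨m, hm⟩ : ∃ m : ℕ, x + m ∉ P '' {s | s.1 ∈ K} :=
    (((finite_sides hK).image P).preimage
      ((add_right_injective x).comp Nat.cast_injective).injOn).exists_notMem
  have hval {s : T.Side} (hs : P s = x) : P (W^[m] s) = x + m := by rw [hiter, hs]
  have houter {s : T.Side} (hs : P s = x) : (W^[m] s).1 ∉ K := fun h ↦ hm ⟨_, h, hval hs⟩
  have hinj : Set.InjOn (fun s ↦ e.map (W^[m] s)) {s | P s = x} := fun s hs t ht h ↦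
    hW.iterate m (e.injOn_map (houter hs) (houter ht) h)
  have hmaps : Set.MapsTo (fun s ↦ e.map (W^[m] s)) {s | P s = x} {t | latticeDev ζ q t = x + m} :=
    fun s hs ↦ (hout _ (houter hs)).symm.trans (hval hs)
  exact (Set.encard_le_encard_of_injOn hmaps hinj).trans
    (encard_latticeDev_eq_le hζ (latticePos_injective hζ) q _)

/-! ### The two exceptional vertices -/

section Exceptional

variable {T : TriangleGluing} {K : Set T.Face}

theorem OuterIso.ncard_start_mem_exceptional_add {n : ℕ} (hK : K.Finite) (hn : 0 < n)
    (e : OuterIso T regular K (box n)) :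
    {s | T.start s ∈ T.exceptional}.ncard + 6 * ((T.verticesOf K).ncard + K.ncard) =
      3 * (T.sidesOf K).ncard + 6 + 6 * T.exceptional.ncard := by
  have hdegrees := e.ncard_start_mem_exceptional hK hn
  have hsides := ncard_sidesOf hK
  rw [e.ncard_boundarySides, ncard_boundarySides_box] at hsides
  omega

theorem OuterIso.ncard_start_mem_exceptional_le {n : ℕ} (hacyclic : T.IsAcyclic K) (hK : K.Finite)
    (hn : 0 < n) (e : OuterIso T regular K (box n)) (hne : T.exceptional.Nonempty) :
    {s | T.start s ∈ T.exceptional}.ncard ≤ 6 * T.exceptional.ncard := by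
  obtain ⟨v, hv⟩ := hne
  obtain ⟨s, hs, -⟩ := e.exceptional_subset hv
  have heuler := hacyclic.ncard_sidesOf_add_two_le hK ⟨s.1, hs⟩
  have hcount := e.ncard_start_mem_exceptional_add hK hn
  omega

theorem exists_isPeriodicPt_of_exceptional (hexc : T.exceptional.Nontrivial)
    (hle : {s | T.start s ∈ T.exceptional}.ncard ≤ 12)
    (hfin : {s | T.start s ∈ T.exceptional}.Finite) {s : T.Side}
    (hs : T.start s ∈ T.exceptional) : ∃ d : ℕ, Function.IsPeriodicPt T.rotate d s ∧ ¬ 6 ∣ d := by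
  obtain ⟨v, hv, hne⟩ := hexc.exists_ne (T.start s)
  obtain ⟨t, rfl⟩ := T.start_surjective v
  have hssub : {t | T.start t = T.start s} ⊂ {t | T.start t ∈ T.exceptional} :=
    ⟨fun u (hu : T.start u = T.start s) ↦ show T.start u ∈ T.exceptional by rwa [hu],
      fun h ↦ hne (h hv)⟩
  have hfin' := hfin.subset hssub.subset
  have hlt := Set.ncard_lt_ncard hssub hfin
  have hpos : 0 < {t | T.start t = T.start s}.ncard := (Set.ncard_pos hfin').2 ⟨s, rfl⟩
  have hdegree : T.degree (T.start s) = {t | T.start t = T.start s}.ncard :=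
    hfin'.cast_ncard_eq.symm
  have hne6 : {t | T.start t = T.start s}.ncard ≠ 6 := fun h ↦ hs (by rw [hdegree, h]; rfl)
  refine ⟨_, (degree_start_eq_coe_iff hpos.ne').1 hdegree ▸ Function.isPeriodicPt_minimalPeriod _ _,
    ?_⟩
  omega

theorem OuterIso.edgeDefect_exact_of_encard_exceptional_eq_two {k : Type*} [Field k] {ζ : k}
    {n : ℕ} (hT : T.IsPlane) (hacyclic : T.IsAcyclic K) (hK : K.Finite) (hn : 0 < n)
    (e : OuterIso T regular K (box n)) (htwo : T.exceptional.encard = 2)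
    (hζ : IsPrimitiveRoot ζ 6) :
    (e.edgeDefect ζ).range = (T.vertexDefect K ζ).ker ∧
      {s | T.start s ∈ T.exceptional}.encard = 12 ∧
      ∀ s, T.start s ∈ T.exceptional →
        ∃ d : ℕ, Function.IsPeriodicPt T.rotate d s ∧ ζ ^ d ≠ 1 := by
  have hncard : T.exceptional.ncard = 2 := by
    rw [Set.ncard, htwo]
    rfl
  have hnontrivial : T.exceptional.Nontrivial := by
    rw [← Set.one_lt_encard_iff_nontrivial, htwo]
    norm_num
  have hfin := e.finite_start_mem_exceptional hK
  have hle := e.ncard_start_mem_exceptional_le hacyclic hK hn hnontrivial.nonempty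
  have hcount := e.ncard_start_mem_exceptional_add hK hn
  have hholonomy (s : T.Side) (hs : T.start s ∈ T.exceptional) :
      ∃ d : ℕ, Function.IsPeriodicPt T.rotate d s ∧ ζ ^ d ≠ 1 := by
    obtain ⟨d, hds, hd⟩ := exists_isPeriodicPt_of_exceptional hnontrivial (by omega) hfin hs
    exact ⟨d, hds, mt (hζ.pow_eq_one_iff_dvd d).1 hd⟩
  obtain ⟨v₀, hv₀⟩ := hnontrivial.nonempty
  obtain ⟨t₀, rfl⟩ := T.start_surjective v₀
  obtain ⟨d, ht₀, hd⟩ := hholonomy t₀ hv₀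
  have : Infinite regular.Face := inferInstanceAs (Infinite (ℤ × ℤ × Bool))
  obtain ⟨t, ht⟩ := (finite_box n).exists_notMem
  obtain ⟨hexact, heuler⟩ := e.range_edgeDefect_eq_ker hT hacyclic hK htwo
    (sq_eq_sub_one_of_isPrimitiveRoot hζ) (e.inv_outer (t, 0) ht) hv₀ ht₀ hd
  have htwelve : {s | T.start s ∈ T.exceptional}.ncard = 12 := by omega
  refine ⟨hexact, ?_, hholonomy⟩
  rw [← hfin.cast_ncard_eq, htwelve]
  rfl

end Exceptional

end TriangleGluing

theorem mainTheorem9 (T : TriangleGluing) (hplane : T.IsPlane)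
    (htwo : T.exceptional.encard = 2) :
    ¬ TriangleGluing.IsoNearInfinity T TriangleGluing.regular := by
  intro hiso
  obtain ⟨n, K, hn, hK, hacyclic, ⟨e⟩⟩ := hplane.exists_outerIso_box hiso
  have hprim := Complex.isPrimitiveRoot_exp 6 (by norm_num)
  have hζ := TriangleGluing.sq_eq_sub_one_of_isPrimitiveRoot hprim
  obtain ⟨hexact, htwelve, hholonomy⟩ :=
    e.edgeDefect_exact_of_encard_exceptional_eq_two hplane hacyclic hK hn htwo hprim
  obtain ⟨q, P, hP, hout⟩ := e.exists_isDevelopment hζ hexact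
  have hzero : {s | T.start s ∈ T.exceptional} ⊆ {s | P s = 0} := by
    intro s hs
    obtain ⟨d, hds, hd⟩ := hholonomy s hs
    exact hP.eq_zero_of_isPeriodicPt hds hd
  have hsix := (Set.encard_le_encard hzero).trans (hP.encard_eq_le hK e hζ hout 0)
  rw [htwelve] at hsix
  exact absurd hsix (by norm_num)
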